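/- **Knowledge bases.** Roles are $p$ and $p^-$ for role names $p$ (with $(p^-)^-=p$). An $\mathcal{ELHI}_\bot$ TBox $\mathcal T$ in normal form is a finite set of role inclusions $r\sqsubseteq r'$, negative role inclusions $r\sqcap r'\sqsubseteq\bot$, and concept inclusions of the forms $A\sqsubseteq\bot$, $A\sqsubseteq\exists r.B$, $\top\sqsubseteq A$, $B_1\sqcap B_2\sqsubseteq A$, $\exists r.B\sqsubseteq A$, with $A,B,B_1,B_2$ concept names. An ABox $\mathcal A$ is a finite non-empty set of assertions $r(a,b)$ and $C(a)$, with $C$ a conjunction of concept names (possibly the empty one, $\top$); $\mathrm{Ind}(\mathcal A)$ is the set of individuals in $\mathcal A$ (there are infinitely many individuals, and no unique name assumption is made). Conjunctions below are finite conjunctions of concept names, possibly empty. The knowledge base $\langle\mathcal T,\mathcal A\rangle$ is assumed consistent. **Canonical model.** The domain of $\mathcal I_{\mathcal T,\mathcal A}$ is the set of sequences $a r_1C_1\cdots r_nC_n$ ($n\ge0$) with $a\in\mathrm{Ind}(\mathcal A)$, roles $r_i$ and conjunctions $C_i$ such that $\mathcal T,\mathcal A\models(\exists r_1.C_1)(a)$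 if $n\ge1$, and $\mathcal T\models C_i\sqsubseteq\exists r_{i+1}.C_{i+1}$ for $1\le i<n$. An individual $a\in\mathrm{Ind}(\mathcal A)$ denotes itself and belongs to $A$ iff $\mathcal T,\mathcal A\models A(a)$; a sequence with last conjunction $C_n$ belongs to $A$ iff $\mathcal T\models C_n\sqsubseteq A$. A pair of individuals $(a,b)$ belongs to $p$ iff there is $r(a,b)\in\mathcal A$ with $\mathcal T\models r\sqsubseteq p$ or $r(b,a)\in\mathcal A$ with $\mathcal T\models r\sqsubseteq p^-$; moreover $(o,orC)\in p$ if $\mathcal T\models r\sqsubseteq p$ and $(orC,o)\in p$ if $\mathcal T\models r\sqsubseteq p^-$; no other pair belongs to $p$. Individuals outside $\mathrm{Ind}(\mathcal A)$ are not interpreted. **Queries.** A (reduced) nested NFA family $\mathbf A=\{\alpha_1,\dots,\alpha_n\}$ consists of finite automata $\alpha_l=(S_l,\iota_l,\delta_l,F_l)$ with pairwise disjoint state sets, whose transitions are labelled by roles, tests $\{a\}?$ and $A?$ (which hold at pairs $(o,o)$ with $o=a$, resp. $o\in A$), or nested tests $\langle j\rangle$ with $l<j\le n$. For a state $s\in S_l$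 and $F\subseteq S_l$, the pair $(o,o')$ belongs to $\mathbf A_{s,F}$ in an interpretation iff some sequence of transitions of $\alpha_l$ leads from $(o,s)$ to $(o',s')$ with $s'\in F$; a transition $\langle j\rangle$ stays at the same object $o_1$ and requires some $o_2$ with $(o_1,o_2)\in\mathbf A_{\iota_j,F_j}$. Write $\mathbf A_{s,s'}$ for $\mathbf A_{s,\{s'\}}$, and let $\langle\mathbf A_{s,F}\rangle(t)$ say that $(t,o)\in\mathbf A_{s,F}$ for some $o$. A CN2RPQ $q(\vec x)$ is a finite conjunction of atoms $A(t)$ and $\mathbf A_{s,F}(t,t')$, with $t,t'$ variables or individuals; the variables other than the answer variables $\vec x$ are existentially quantified. A tuple $\vec a$ is a certain answer if in every model $\mathcal I$ of the knowledge base some match $\pi$ of $q$ has $\pi(\vec x)=\vec a^{\mathcal I}$. **Jump and final transitions.** A partial run of $\mathbf A$ on an interpretation is a finite tree with nodes labelled by pairs (object, state) in which each inner node $(o,s)$ either has one child $(o',s')$ for a transition $(s,\sigma,s')$ such that $\sigma$ is a role or a test $\{a\}?$ or $A?$ that holds at $(o,o')$, or has two children $(o,s')$ and $(o,\iota_j)$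 for a transition $(s,\langle j\rangle,s')$. Let $C$ be a conjunction of concept names of $\mathcal T$, let $s_1,s_2\in S_i$, $F\subseteq S_i$, $\Gamma\subseteq\bigcup_{j>i}S_j$, and let $a$ be an individual not occurring in $\mathbf A$. Then $(C,s_1,s_2,\Gamma)$ is a jump transition if $\mathcal I_{\mathcal T,\{C(a)\}}$ admits a partial run with root $(a,s_1)$ and a leaf $(a,s_2)$ in which every leaf $(o,s)\ne(a,s_2)$ has $s\in F_j$ for some $j>i$, or $o=a$ and $s\in\Gamma$. And $(C,s_1,F,\Gamma)$ is a final transition if $\mathcal I_{\mathcal T,\{C(a)\}}$ admits a partial run with root $(a,s_1)$ and some leaf whose state is in $F$, in which every leaf $(o,s)$ has $s\in\bigcup_kF_k$, or $o=a$ and $s\in\Gamma$. **Rewriting.** $\mathrm{rewrite}(q,\mathcal T)$ is the set of queries obtained from $q$ by any finite number ($\ge0$) of repetitions of the following nondeterministic step. (1) Choose a non-empty set $L$ of quantified variables of $q$ and $y\in L$, and rename all variables in $L$ to $y$. (2) Choose a conjunction $C$ of concept names of $\mathcal T$ with $\mathcal T\models C\sqsubseteq B$ for every atom $B(y)$, and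 drop these atoms. (3) For each atom $\mathbf A_{s_0,F}(t,t')$ with $y\in\{t,t'\}$ and each atom $\langle\mathbf A_{s_0,F}\rangle(y)$, with $s_0\in S_i$, choose $n\ge1$, distinct $s_1,\dots,s_{n-1}\in S_i$ and $s_n\in F$. Replace the first kind of atom by $\mathbf A_{s_0,s_1}(t,y),\mathbf A_{s_1,s_2}(y,y),\dots,\mathbf A_{s_{n-1},s_n}(y,t')$ (by $\mathbf A_{s_0,s_1}(t,t')$ if $n=1$), and the second by $\mathbf A_{s_0,s_1}(y,y),\dots,\mathbf A_{s_{n-2},s_{n-1}}(y,y),\langle\mathbf A_{s_{n-1},s_n}\rangle(y)$. (4) Each atom $\mathbf A_{s,s'}(y,y)$ (resp. $\langle\mathbf A_{s,s'}\rangle(y)$) is either kept or, for a chosen jump transition $(C,s,s',\Gamma)$ (resp. final transition $(C,s,\{s'\},\Gamma)$), replaced by the atoms $\langle\mathbf A_{u,F_k}\rangle(y)$ with $u\in\Gamma\cap S_k$; the new atoms are not treated again in this item. (5) Choose a conjunction $D$ of concept names of $\mathcal T$ and a role $r$ with $\mathcal T\models D\sqsubseteq\exists r.C$. For an atom with first component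 $\mathbf A_{u,U}$, $u\in S_i$, call $v\in S_i$ an up-state if $(u,r_1^-,v)\in\delta_i$ for some role $r_1$ with $\mathcal T\models r\sqsubseteq r_1$, and call $v'\in S_i$ a down-state if $(v',r_2,v'')\in\delta_i$ for some $v''\in U$ and some role $r_2$ with $\mathcal T\models r\sqsubseteq r_2$. Replace, with a choice of such states for each atom (the step fails if there are none), $\mathbf A_{u,U}(y,t)$ with $t\ne y$ by $\mathbf A_{v,U}(y,t)$; $\mathbf A_{u,U}(t,y)$ with $t\neq y$ by $\mathbf A_{u,v'}(t,y)$; $\mathbf A_{u,U}(y,y)$ by $\mathbf A_{v,v'}(y,y)$; and $\langle\mathbf A_{u,U}\rangle(y)$ by $\langle\mathbf A_{v,U}\rangle(y)$. (6) Add $A(y)$ for every concept name $A$ in $D$. **Proposition.** Let $\langle\mathcal T,\mathcal A\rangle$ be a consistent $\mathcal{ELHI}_\bot$ knowledge base in normal form as above, let $q(\vec x)$ be a CN2RPQ all of whose individuals (those in tests $\{a\}?$ of its automata included) occur in $\mathcal A$, and let $\vec a$ be a tuple of individuals of $\mathcal A$ of the length of $\vec x$. Then $\vec a$ is a certain answer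 to $q$ over $\langle\mathcal T,\mathcal A\rangle$ if and only if there are $q'\in\mathrm{rewrite}(q,\mathcal T)$ and a match $\pi$ of $q'$ in $\mathcal I_{\mathcal T,\mathcal A}$ with $\pi(\vec x)=\vec a$ and $\pi(y)\in\mathrm{Ind}(\mathcal A)$ for every variable $y$ of $q'$. The same equivalence holds for the certain answers to every CN2RPQ written with nested regular expressions instead of automata, when $q$ is obtained from it by replacing each expression with an equivalent nested automaton. -/

import Mathlib

namespace NestedQuery

/-! ### Syntax of ELHI⊥ with negative role inclusions -/

/-- Roles: role names and their inverses. -/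
inductive Role (RN : Type) : Type
  | pos (p : RN)
  | neg (p : RN)

/-- The inverse role, with the inverse of the inverse of `p` identified with `p`. -/
def Role.inv {RN : Type} : Role RN → Role RN
  | .pos p => .neg p
  | .neg p => .pos p

/-- Complex concepts. -/
inductive Concept (CN RN : Type) : Type
  | top
  | bot
  | name (A : CN)
  | ex (r : Role RN) (C : Concept CN RN)
  | inf (C D : Concept CN RN)

/-- The conjunction of a finite set of concept names; the empty one is `⊤`. -/
noncomputable def Concept.conj {CN RN : Type} (C : Finset CN) : Concept CN RN :=
  (C.toList.map Concept.name).foldr Concept.inf Concept.top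

/-- Concepts that are conjunctions of concept names (possibly `⊤`). -/
def Concept.IsConj {CN RN : Type} : Concept CN RN → Prop
  | .top => True
  | .bot => False
  | .name _ => True
  | .ex _ _ => False
  | .inf C D => C.IsConj ∧ D.IsConj

/-- The concept names occurring in a concept. -/
def Concept.names {CN RN : Type} : Concept CN RN → Set CN
  | .top => ∅
  | .bot => ∅
  | .name A => {A}
  | .ex _ C => C.names
  | .inf C D => C.names ∪ D.names

/-- TBox axioms: concept inclusions, positive role inclusions `r ⊑ r'`, and
negative role inclusions `r ⊓ r' ⊑ ⊥`. -/
inductive TAxiom (CN RN : Type) : Type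
  | ci (C D : Concept CN RN)
  | ri (r r' : Role RN)
  | nri (r r' : Role RN)

def TAxiom.names {CN RN : Type} : TAxiom CN RN → Set CN
  | .ci C D => C.names ∪ D.names
  | .ri _ _ => ∅
  | .nri _ _ => ∅

abbrev TBox (CN RN : Type) : Type := Finset (TAxiom CN RN)

/-- The concept names occurring in a TBox. -/
def TBox.names {CN RN : Type} (T : TBox CN RN) : Set CN :=
  {A | ∃ ax ∈ T, A ∈ ax.names}

/-- The shapes of concept inclusions that a TBox in normal form may contain
(role inclusions are not restricted). -/
inductive TAxiom.IsNormal {CN RN : Type} : TAxiom CN RN → Prop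
  | bot (A : CN) : IsNormal (.ci (.name A) .bot)
  | ex (A : CN) (r : Role RN) (B : CN) : IsNormal (.ci (.name A) (.ex r (.name B)))
  | top (A : CN) : IsNormal (.ci .top (.name A))
  | inf (B₁ B₂ A : CN) : IsNormal (.ci (.inf (.name B₁) (.name B₂)) (.name A))
  | exl (r : Role RN) (B A : CN) : IsNormal (.ci (.ex r (.name B)) (.name A))
  | ri (r r' : Role RN) : IsNormal (.ri r r')
  | nri (r r' : Role RN) : IsNormal (.nri r r')

def TBox.IsNormal {CN RN : Type} (T : TBox CN RN) : Prop := ∀ ax ∈ T, ax.IsNormal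

inductive Assertion (CN RN IN : Type) : Type
  | concept (C : Concept CN RN) (a : IN)
  | role (r : Role RN) (a b : IN)

def Assertion.inds {CN RN IN : Type} : Assertion CN RN IN → Set IN
  | .concept _ a => {a}
  | .role _ a b => {a, b}

abbrev ABox (CN RN IN : Type) : Type := Finset (Assertion CN RN IN)

/-- The individuals occurring in an ABox. -/
def ABox.inds {CN RN IN : Type} (𝒜 : ABox CN RN IN) : Set IN :=
  {a | ∃ as ∈ 𝒜, a ∈ as.inds}

/-- Concept assertions `C(a)` only use conjunctions `C` of concept names (possibly `⊤`). -/
def ABox.IsNormal {CN RN IN : Type} (𝒜 : ABox CN RN IN) : Prop :=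
  ∀ C a, Assertion.concept C a ∈ 𝒜 → C.IsConj

/-! ### Semantics -/

/-- Interpretations. The individuals may be interpreted partially, because a canonical model
interprets only the individuals of its ABox; the interpretations over which entailment and
certain answers quantify are the `Proper` ones. -/
structure Interp (CN RN IN : Type) : Type 1 where
  Dom : Type
  ind : IN → Option Dom
  con : CN → Set Dom
  rol : RN → Set (Dom × Dom)

/-- Non-empty domain, and every individual is interpreted. -/
def Interp.Proper {CN RN IN : Type} (I : Interp CN RN IN) : Prop :=
  Nonempty I.Dom ∧ ∀ a, ∃ d, I.ind a = some d

def Interp.role {CN RN IN : Type} (I : Interp CN RN IN) : Role RN → Set (I.Dom × I.Dom)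
  | .pos p => I.rol p
  | .neg p => {x | (x.2, x.1) ∈ I.rol p}

def Interp.concept {CN RN IN : Type} (I : Interp CN RN IN) : Concept CN RN → Set I.Dom
  | .top => Set.univ
  | .bot => ∅
  | .name A => I.con A
  | .ex r C => {c | ∃ d, (c, d) ∈ I.role r ∧ d ∈ I.concept C}
  | .inf C D => I.concept C ∩ I.concept D

theorem Interp.mem_conj {CN RN IN : Type} (I : Interp CN RN IN) (C : Finset CN) (d : I.Dom) :
    d ∈ I.concept (Concept.conj C) ↔ ∀ A ∈ C, d ∈ I.con A := by
  have h : ∀ l : List CN, d ∈ I.concept ((l.map Concept.name).foldr Concept.inf Concept.top) ↔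
      ∀ A ∈ l, d ∈ I.con A := by
    intro l
    induction l with
    | nil => simp [Interp.concept]
    | cons x l ih => simp [Interp.concept, ih]
  simpa [Concept.conj] using h C.toList

def Interp.SatT {CN RN IN : Type} (I : Interp CN RN IN) : TAxiom CN RN → Prop
  | .ci C D => I.concept C ⊆ I.concept D
  | .ri r r' => I.role r ⊆ I.role r'
  | .nri r r' => I.role r ∩ I.role r' = ∅

def Interp.SatA {CN RN IN : Type} (I : Interp CN RN IN) : Assertion CN RN IN → Prop
  | .concept C a => ∃ d, I.ind a = some d ∧ d ∈ I.concept C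
  | .role r a b => ∃ d e, I.ind a = some d ∧ I.ind b = some e ∧ (d, e) ∈ I.role r

/-- `I` is a model of the TBox `T`. -/
def Interp.ModelsT {CN RN IN : Type} (I : Interp CN RN IN) (T : TBox CN RN) : Prop :=
  I.Proper ∧ ∀ ax ∈ T, I.SatT ax

/-- `I` is a model of the knowledge base `(T, 𝒜)`. -/
def Interp.Models {CN RN IN : Type} (I : Interp CN RN IN) (T : TBox CN RN)
    (𝒜 : ABox CN RN IN) : Prop :=
  I.ModelsT T ∧ ∀ as ∈ 𝒜, I.SatA as

/-- Consistency of a knowledge base (the unique name assumption is not made). -/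
def Consistent {CN RN IN : Type} (T : TBox CN RN) (𝒜 : ABox CN RN IN) : Prop :=
  ∃ I : Interp CN RN IN, I.Models T 𝒜

/-- `T ⊨ ax`. -/
def EntailsT {CN RN : Type} (IN : Type) (T : TBox CN RN) (ax : TAxiom CN RN) : Prop :=
  ∀ I : Interp CN RN IN, I.ModelsT T → I.SatT ax

/-- `T, 𝒜 ⊨ as`. -/
def EntailsA {CN RN IN : Type} (T : TBox CN RN) (𝒜 : ABox CN RN IN)
    (as : Assertion CN RN IN) : Prop :=
  ∀ I : Interp CN RN IN, I.Models T 𝒜 → I.SatA as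

/-! ### Canonical models -/

/-- `ValidPath T 𝒜 a l` says that the sequence `a r₁ C₁ … rₙ Cₙ` is an element of the domain of
the canonical model. The list `l = [(rₙ, Cₙ), …, (r₁, C₁)]` holds the steps, last step first. -/
def ValidPath {CN RN IN : Type} (T : TBox CN RN) (𝒜 : ABox CN RN IN) (a : IN) :
    List (Role RN × Finset CN) → Prop
  | [] => a ∈ 𝒜.inds
  | [(r, C)] => a ∈ 𝒜.inds ∧ EntailsA T 𝒜 (.concept (.ex r (.conj C)) a)
  | (r, C) :: (r', C') :: l =>
      EntailsT IN T (.ci (.conj C') (.ex r (.conj C))) ∧ ValidPath T 𝒜 a ((r', C') :: l)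

abbrev CanDom {CN RN IN : Type} (T : TBox CN RN) (𝒜 : ABox CN RN IN) : Type :=
  {o : IN × List (Role RN × Finset CN) // ValidPath T 𝒜 o.1 o.2}

/-- The object `a r₁ C₁ … rₙ Cₙ` belongs to the concept name `A`: for `n = 0` iff
`T, 𝒜 ⊨ A(a)`, for `n ≥ 1` iff `T ⊨ Cₙ ⊑ A`. -/
def CanCon {CN RN IN : Type} (T : TBox CN RN) (𝒜 : ABox CN RN IN) (A : CN) :
    IN × List (Role RN × Finset CN) → Prop
  | (a, []) => EntailsA T 𝒜 (.concept (.name A) a)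
  | (_, (_, C) :: _) => EntailsT IN T (.ci (.conj C) (.name A))

/-- The pair `(o, o')` belongs to the role name `p`. Between individuals, this holds iff
some asserted role (read in either direction) is included in `p` by `T`. -/
def CanRol {CN RN IN : Type} (T : TBox CN RN) (𝒜 : ABox CN RN IN) (p : RN)
    (o o' : IN × List (Role RN × Finset CN)) : Prop :=
  (o.2 = [] ∧ o'.2 = [] ∧ ∃ r, Assertion.role r o.1 o'.1 ∈ 𝒜 ∧ EntailsT IN T (.ri r (.pos p))) ∨
  (o.2 = [] ∧ o'.2 = [] ∧ ∃ r, Assertion.role r o'.1 o.1 ∈ 𝒜 ∧ EntailsT IN T (.ri r (.neg p))) ∨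
  (∃ r C, o' = (o.1, (r, C) :: o.2) ∧ EntailsT IN T (.ri r (.pos p))) ∨
  (∃ r C, o = (o'.1, (r, C) :: o'.2) ∧ EntailsT IN T (.ri r (.neg p)))

open Classical in
/-- The canonical model of `(T, 𝒜)`. -/
noncomputable def canModel {CN RN IN : Type} (T : TBox CN RN) (𝒜 : ABox CN RN IN) :
    Interp CN RN IN where
  Dom := CanDom T 𝒜
  ind := fun a => if h : a ∈ 𝒜.inds then some ⟨(a, []), h⟩ else none
  con := fun A => {o | CanCon T 𝒜 A o.1}
  rol := fun p => {x | CanRol T 𝒜 p x.1.1 x.2.1}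

/-! ### Nested regular expressions and nested automata -/

/-- The set of roles used as symbols: roles, tests `{a}?`, and tests `A?`. -/
inductive Sym (CN RN IN : Type) : Type
  | role (r : Role RN)
  | testInd (a : IN)
  | testCon (A : CN)

def Interp.sym {CN RN IN : Type} (I : Interp CN RN IN) : Sym CN RN IN → Set (I.Dom × I.Dom)
  | .role r => I.role r
  | .testInd a => {x | x.1 = x.2 ∧ I.ind a = some x.1}
  | .testCon A => {x | x.1 = x.2 ∧ x.1 ∈ I.con A}

inductive NRE (CN RN IN : Type) : Type
  | sym (σ : Sym CN RN IN)
  | comp (E₁ E₂ : NRE CN RN IN)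
  | union (E₁ E₂ : NRE CN RN IN)
  | star (E : NRE CN RN IN)
  | nest (E : NRE CN RN IN)

def Interp.nre {CN RN IN : Type} (I : Interp CN RN IN) : NRE CN RN IN → Set (I.Dom × I.Dom)
  | .sym σ => I.sym σ
  | .comp E₁ E₂ => {x | ∃ d, (x.1, d) ∈ I.nre E₁ ∧ (d, x.2) ∈ I.nre E₂}
  | .union E₁ E₂ => I.nre E₁ ∪ I.nre E₂
  | .star E => {x | Relation.ReflTransGen (fun d e => (d, e) ∈ I.nre E) x.1 x.2}
  | .nest E => {x | x.1 = x.2 ∧ ∃ d, (x.1, d) ∈ I.nre E}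

/-- Transition labels: symbols, and nested tests `⟨j⟩`. -/
inductive Label (CN RN IN : Type) (n : ℕ) : Type
  | sym (σ : Sym CN RN IN)
  | nest (j : Fin n)

/-- A (reduced) indexed family `𝒩 = {α₁, …, αₙ}` of nested automata. The state sets are pairwise
disjoint; `S` is their union and `idx s` is the index of the automaton that contains the state `s`.
A transition of `α_l` labelled `⟨j⟩` requires `l < j`. -/
structure NNFA (CN RN IN : Type) : Type 1 where
  n : ℕ
  S : Type
  idx : S → Fin n
  init : Fin n → S
  final : Set S
  delta : Set (S × Label CN RN IN n × S)
  finite_states : Finite S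
  finite_delta : delta.Finite
  idx_init : ∀ j, idx (init j) = j
  idx_delta : ∀ s σ s', (s, σ, s') ∈ delta → idx s = idx s'
  nest_lt : ∀ s j s', (s, Label.nest j, s') ∈ delta → idx s < j

/-- The final states `F_j` of the automaton `α_j`. -/
def NNFA.F {CN RN IN : Type} (𝒩 : NNFA CN RN IN) (j : Fin 𝒩.n) : Set 𝒩.S :=
  {f | f ∈ 𝒩.final ∧ 𝒩.idx f = j}

/-- The individuals `a` for which some transition is labelled `{a}?`. -/
def NNFA.inds {CN RN IN : Type} (𝒩 : NNFA CN RN IN) : Set IN :=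
  {a | ∃ s s', (s, Label.sym (Sym.testInd a), s') ∈ 𝒩.delta}

/-- `Reach I 𝒩 o s o' s'`: there is a sequence `s o … s' o'` of states and objects that follows the
transitions of the automaton of `s`. A transition `⟨j⟩` stays at the same object, from which the
nested automaton `α_j` must be able to reach one of its final states. -/
inductive Reach {CN RN IN : Type} (I : Interp CN RN IN) (𝒩 : NNFA CN RN IN) :
    I.Dom → 𝒩.S → I.Dom → 𝒩.S → Prop
  | refl (o : I.Dom) (s : 𝒩.S) : Reach I 𝒩 o s o s
  | sym {o o' o'' : I.Dom} {s s' s'' : 𝒩.S} {σ : Sym CN RN IN}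
      (hδ : (s, Label.sym σ, s') ∈ 𝒩.delta) (hσ : (o, o') ∈ I.sym σ)
      (h : Reach I 𝒩 o' s' o'' s'') : Reach I 𝒩 o s o'' s''
  | nest {o o₁ o'' : I.Dom} {s s' s'' f : 𝒩.S} {j : Fin 𝒩.n}
      (hδ : (s, Label.nest j, s') ∈ 𝒩.delta)
      (hj : Reach I 𝒩 o (𝒩.init j) o₁ f) (hf : f ∈ 𝒩.F j)
      (h : Reach I 𝒩 o s' o'' s'') : Reach I 𝒩 o s o'' s''

/-- The interpretation of the nested automaton `𝒩_{s₀,F₀}`. -/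
def Interp.nnfa {CN RN IN : Type} (I : Interp CN RN IN) (𝒩 : NNFA CN RN IN) (s₀ : 𝒩.S)
    (F₀ : Set 𝒩.S) : Set (I.Dom × I.Dom) :=
  {x | ∃ f ∈ F₀, Reach I 𝒩 x.1 s₀ x.2 f}

/-! ### Queries -/

inductive Term (IN VN : Type) : Type
  | var (v : VN)
  | ind (a : IN)

/-- The value of a term under an assignment `π` of the variables. -/
def Interp.term {CN RN IN VN : Type} (I : Interp CN RN IN) (π : VN → I.Dom) :
    Term IN VN → Option I.Dom
  | .var v => some (π v)
  | .ind a => I.ind a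

/-- Query atoms `A(t)`, `𝒩_{s,F}(t,t')`, and `⟨𝒩_{s,F}⟩(t)`. -/
inductive Atom (CN RN IN VN : Type) : Type 1
  | concept (A : CN) (t : Term IN VN)
  | role (𝒩 : NNFA CN RN IN) (s : 𝒩.S) (F : Set 𝒩.S) (t t' : Term IN VN)
  | test (𝒩 : NNFA CN RN IN) (s : 𝒩.S) (F : Set 𝒩.S) (t : Term IN VN)

def Atom.terms {CN RN IN VN : Type} : Atom CN RN IN VN → Set (Term IN VN)
  | .concept _ t => {t}
  | .role _ _ _ t t' => {t, t'}
  | .test _ _ _ t => {t}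

/-- The individuals of an atom, those of tests `{a}?` included. -/
def Atom.inds {CN RN IN VN : Type} : Atom CN RN IN VN → Set IN
  | .concept A t => {a | Term.ind a ∈ (Atom.concept A t : Atom CN RN IN VN).terms}
  | .role 𝒩 s F t t' => {a | Term.ind a ∈ (Atom.role 𝒩 s F t t').terms} ∪ 𝒩.inds
  | .test 𝒩 s F t => {a | Term.ind a ∈ (Atom.test 𝒩 s F t).terms} ∪ 𝒩.inds

def Interp.SatAtom {CN RN IN VN : Type} (I : Interp CN RN IN) (π : VN → I.Dom) :
    Atom CN RN IN VN → Prop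
  | .concept A t => ∃ d, I.term π t = some d ∧ d ∈ I.con A
  | .role 𝒩 s F t t' =>
      ∃ d e, I.term π t = some d ∧ I.term π t' = some e ∧ (d, e) ∈ I.nnfa 𝒩 s F
  | .test 𝒩 s F t => ∃ d e, I.term π t = some d ∧ (d, e) ∈ I.nnfa 𝒩 s F

/-- Queries with answer variables `ans` and all other variables existentially quantified; the
set of atoms stands for their conjunction. -/
structure Query (CN RN IN VN : Type) (k : ℕ) : Type 1 where
  ans : Fin k → VN
  atoms : Set (Atom CN RN IN VN)

/-- A CN2RPQ (in automata-based representation): a finite conjunction of atoms `A(t)` and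
`𝒩_{s,F}(t,t')`, where `{s} ∪ F` are states of a single automaton of `𝒩`. -/
structure Query.IsCN2RPQ {CN RN IN VN : Type} {k : ℕ} (q : Query CN RN IN VN k) : Prop where
  finite : q.atoms.Finite
  same_automaton : ∀ 𝒩 s F t t', Atom.role 𝒩 s F t t' ∈ q.atoms → ∀ f ∈ F, 𝒩.idx f = 𝒩.idx s
  no_test : ∀ 𝒩 s F t, Atom.test 𝒩 s F t ∉ q.atoms

def Query.vars {CN RN IN VN : Type} {k : ℕ} (q : Query CN RN IN VN k) : Set VN :=
  {v | ∃ α ∈ q.atoms, Term.var v ∈ α.terms}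

def Query.inds {CN RN IN VN : Type} {k : ℕ} (q : Query CN RN IN VN k) : Set IN :=
  {a | ∃ α ∈ q.atoms, a ∈ α.inds}

/-- `π` is a match for `q` in `I`. The values of `π` outside the variables of `q` are irrelevant. -/
def Query.IsMatch {CN RN IN VN : Type} {k : ℕ} (q : Query CN RN IN VN k) (I : Interp CN RN IN)
    (π : VN → I.Dom) : Prop :=
  ∀ α ∈ q.atoms, I.SatAtom π α

/-- `a` is a certain answer to `q` over `(T, 𝒜)`. -/
def Query.CertainAnswer {CN RN IN VN : Type} {k : ℕ} (q : Query CN RN IN VN k) (T : TBox CN RN)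
    (𝒜 : ABox CN RN IN) (a : Fin k → IN) : Prop :=
  ∀ I : Interp CN RN IN, I.Models T 𝒜 →
    ∃ π : VN → I.Dom, q.IsMatch I π ∧ ∀ i, I.ind (a i) = some (π (q.ans i))

/-! ### Queries over nested regular expressions -/

inductive NREAtom (CN RN IN VN : Type) : Type
  | concept (A : CN) (t : Term IN VN)
  | role (E : NRE CN RN IN) (t t' : Term IN VN)

def Interp.SatNREAtom {CN RN IN VN : Type} (I : Interp CN RN IN) (π : VN → I.Dom) :
    NREAtom CN RN IN VN → Prop
  | .concept A t => ∃ d, I.term π t = some d ∧ d ∈ I.con A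
  | .role E t t' => ∃ d e, I.term π t = some d ∧ I.term π t' = some e ∧ (d, e) ∈ I.nre E

structure NREQuery (CN RN IN VN : Type) (k : ℕ) : Type where
  ans : Fin k → VN
  atoms : Set (NREAtom CN RN IN VN)

def NREQuery.CertainAnswer {CN RN IN VN : Type} {k : ℕ} (q : NREQuery CN RN IN VN k)
    (T : TBox CN RN) (𝒜 : ABox CN RN IN) (a : Fin k → IN) : Prop :=
  ∀ I : Interp CN RN IN, I.Models T 𝒜 →
    ∃ π : VN → I.Dom, (∀ α ∈ q.atoms, I.SatNREAtom π α) ∧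
      ∀ i, I.ind (a i) = some (π (q.ans i))

/-- The automaton of an atom expresses the nested regular expression of the other one. -/
inductive NREAtom.RepresentedBy {CN RN IN VN : Type} :
    NREAtom CN RN IN VN → Atom CN RN IN VN → Prop
  | concept (A : CN) (t : Term IN VN) : RepresentedBy (.concept A t) (.concept A t)
  | role (E : NRE CN RN IN) (𝒩 : NNFA CN RN IN) (s : 𝒩.S) (F : Set 𝒩.S) (t t' : Term IN VN)
      (h : ∀ I : Interp CN RN IN, I.Proper → I.nre E = I.nnfa 𝒩 s F) :
      RepresentedBy (.role E t t') (.role 𝒩 s F t t')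

/-- `q` arises from `q₀` by replacing nested regular expressions with equivalent automata. -/
def NREQuery.RepresentedBy {CN RN IN VN : Type} {k : ℕ} (q₀ : NREQuery CN RN IN VN k)
    (q : Query CN RN IN VN k) : Prop :=
  q₀.ans = q.ans ∧ (∀ α ∈ q₀.atoms, ∃ β ∈ q.atoms, α.RepresentedBy β) ∧
    (∀ β ∈ q.atoms, ∃ α ∈ q₀.atoms, α.RepresentedBy β)

/-! ### Partial runs, jump and final transitions -/

/-- Finite trees with at most binary branching and labelled nodes. -/
inductive RunTree (X : Type) : Type
  | leaf (x : X)
  | one (x : X) (t : RunTree X)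
  | two (x : X) (t t' : RunTree X)

def RunTree.root {X : Type} : RunTree X → X
  | .leaf x => x
  | .one x _ => x
  | .two x _ _ => x

/-- The labels of the leaves. -/
def RunTree.leaves {X : Type} : RunTree X → Set X
  | .leaf x => {x}
  | .one _ t => t.leaves
  | .two _ t t' => t.leaves ∪ t'.leaves

/-- The tree is a partial run for `𝒩` on `I`. -/
def IsRun {CN RN IN : Type} (I : Interp CN RN IN) (𝒩 : NNFA CN RN IN) :
    RunTree (I.Dom × 𝒩.S) → Prop
  | .leaf _ => True
  | .one x t =>
      (∃ σ, (x.2, Label.sym σ, t.root.2) ∈ 𝒩.delta ∧ (x.1, t.root.1) ∈ I.sym σ) ∧ IsRun I 𝒩 t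
  | .two x t t' =>
      (∃ j, (x.2, Label.nest j, t.root.2) ∈ 𝒩.delta ∧ t.root.1 = x.1 ∧
        t'.root = (x.1, 𝒩.init j)) ∧ IsRun I 𝒩 t ∧ IsRun I 𝒩 t'

/-- `(C, s₁, s₂, Γ)` is a jump transition. The individual `a` of the one-assertion ABox `{C(a)}`
does not occur in `𝒩`, so that no test `{b}?` holds in its canonical model. -/
def JumpTrans {CN RN IN : Type} (T : TBox CN RN) (𝒩 : NNFA CN RN IN) (C : Finset CN)
    (s₁ s₂ : 𝒩.S) (Γ : Set 𝒩.S) : Prop :=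
  ↑C ⊆ T.names ∧ 𝒩.idx s₁ = 𝒩.idx s₂ ∧ (∀ u ∈ Γ, 𝒩.idx s₁ < 𝒩.idx u) ∧
  ∃ a : IN, a ∉ 𝒩.inds ∧
  ∃ (o : (canModel T {Assertion.concept (.conj C) a}).Dom)
    (t : RunTree ((canModel T {Assertion.concept (.conj C) a}).Dom × 𝒩.S)),
    (canModel T {Assertion.concept (.conj C) a}).ind a = some o ∧
    IsRun (canModel T {Assertion.concept (.conj C) a}) 𝒩 t ∧
    t.root = (o, s₁) ∧ (o, s₂) ∈ t.leaves ∧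
    ∀ x ∈ t.leaves, x ≠ (o, s₂) →
      (∃ j, 𝒩.idx s₁ < j ∧ x.2 ∈ 𝒩.F j) ∨ (x.1 = o ∧ x.2 ∈ Γ)

/-- `(C, s₁, F, Γ)` is a final transition. -/
def FinalTrans {CN RN IN : Type} (T : TBox CN RN) (𝒩 : NNFA CN RN IN) (C : Finset CN)
    (s₁ : 𝒩.S) (F : Set 𝒩.S) (Γ : Set 𝒩.S) : Prop :=
  ↑C ⊆ T.names ∧ (∀ f ∈ F, 𝒩.idx f = 𝒩.idx s₁) ∧ (∀ u ∈ Γ, 𝒩.idx s₁ < 𝒩.idx u) ∧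
  ∃ a : IN, a ∉ 𝒩.inds ∧
  ∃ (o : (canModel T {Assertion.concept (.conj C) a}).Dom)
    (t : RunTree ((canModel T {Assertion.concept (.conj C) a}).Dom × 𝒩.S)),
    (canModel T {Assertion.concept (.conj C) a}).ind a = some o ∧
    IsRun (canModel T {Assertion.concept (.conj C) a}) 𝒩 t ∧
    t.root = (o, s₁) ∧ (∃ x ∈ t.leaves, x.2 ∈ F) ∧
    ∀ x ∈ t.leaves, (∃ j, x.2 ∈ 𝒩.F j) ∨ (x.1 = o ∧ x.2 ∈ Γ)

/-! ### The rewriting procedure -/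

open Classical in
/-- Rename all variables of `L` to `y`. -/
noncomputable def Term.rename {IN VN : Type} (L : Set VN) (y : VN) : Term IN VN → Term IN VN
  | .var v => if v ∈ L then .var y else .var v
  | .ind a => .ind a

noncomputable def Atom.rename {CN RN IN VN : Type} (L : Set VN) (y : VN) :
    Atom CN RN IN VN → Atom CN RN IN VN
  | .concept A t => .concept A (t.rename L y)
  | .role 𝒩 s F t t' => .role 𝒩 s F (t.rename L y) (t'.rename L y)
  | .test 𝒩 s F t => .test 𝒩 s F (t.rename L y)

/-- For `l = [s₁, …, s_{n-1}]`, the atoms `𝒩_{s₀,s₁}(t,y)`, `𝒩_{s₁,s₂}(y,y)`, …,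
`𝒩_{s_{n-1},sₙ}(y,t')`; for empty `l`, the atom `𝒩_{s₀,sₙ}(t,t')`. -/
def roleChain {CN RN IN VN : Type} (𝒩 : NNFA CN RN IN) (y : VN) (t' : Term IN VN) (sn : 𝒩.S) :
    Term IN VN → 𝒩.S → List 𝒩.S → Set (Atom CN RN IN VN)
  | t, s₀, [] => {.role 𝒩 s₀ {sn} t t'}
  | t, s₀, s₁ :: l => {.role 𝒩 s₀ {s₁} t (.var y)} ∪ roleChain 𝒩 y t' sn (.var y) s₁ l

/-- For `l = [s₁, …, s_{n-1}]`, the atoms `𝒩_{s₀,s₁}(y,y)`, …, `𝒩_{s_{n-2},s_{n-1}}(y,y)`,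
`⟨𝒩_{s_{n-1},sₙ}⟩(y)`. -/
def testChain {CN RN IN VN : Type} (𝒩 : NNFA CN RN IN) (y : VN) (sn : 𝒩.S) :
    𝒩.S → List 𝒩.S → Set (Atom CN RN IN VN)
  | s₀, [] => {.test 𝒩 s₀ {sn} (.var y)}
  | s₀, s₁ :: l => {.role 𝒩 s₀ {s₁} (.var y) (.var y)} ∪ testChain 𝒩 y sn s₁ l

/-- Decomposition of an atom into a set of atoms: atoms without `y` stay, the others are split
along distinct intermediate states and one final state. -/
inductive Decompose {CN RN IN VN : Type} (y : VN) :
    Atom CN RN IN VN → Set (Atom CN RN IN VN) → Prop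
  | keep (α : Atom CN RN IN VN) (h : Term.var y ∉ α.terms) : Decompose y α {α}
  | role (𝒩 : NNFA CN RN IN) (s₀ : 𝒩.S) (F : Set 𝒩.S) (t t' : Term IN VN)
      (l : List 𝒩.S) (sn : 𝒩.S) (hy : t = .var y ∨ t' = .var y) (hd : l.Nodup)
      (hl : ∀ s ∈ l, 𝒩.idx s = 𝒩.idx s₀) (hn : sn ∈ F) :
      Decompose y (.role 𝒩 s₀ F t t') (roleChain 𝒩 y t' sn t s₀ l)
  | test (𝒩 : NNFA CN RN IN) (s₀ : 𝒩.S) (F : Set 𝒩.S)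
      (l : List 𝒩.S) (sn : 𝒩.S) (hd : l.Nodup)
      (hl : ∀ s ∈ l, 𝒩.idx s = 𝒩.idx s₀) (hn : sn ∈ F) :
      Decompose y (.test 𝒩 s₀ F (.var y)) (testChain 𝒩 y sn s₀ l)

/-- The atoms `⟨𝒩_{u,F_k}⟩(y)` for `u ∈ Γ ∩ S_k`. -/
def pendingAtoms {CN RN IN VN : Type} (𝒩 : NNFA CN RN IN) (y : VN) (Γ : Set 𝒩.S) :
    Set (Atom CN RN IN VN) :=
  {α | ∃ u ∈ Γ, α = .test 𝒩 u (𝒩.F (𝒩.idx u)) (.var y)}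

/-- An atom is kept, or it is replaced by means of a jump or final transition. -/
inductive Shortcut {CN RN IN VN : Type} (T : TBox CN RN) (C : Finset CN) (y : VN) :
    Atom CN RN IN VN → Set (Atom CN RN IN VN) → Prop
  | keep (α : Atom CN RN IN VN) : Shortcut T C y α {α}
  | jump (𝒩 : NNFA CN RN IN) (s s' : 𝒩.S) (Γ : Set 𝒩.S) (h : JumpTrans T 𝒩 C s s' Γ) :
      Shortcut T C y (.role 𝒩 s {s'} (.var y) (.var y)) (pendingAtoms 𝒩 y Γ)
  | final (𝒩 : NNFA CN RN IN) (s s' : 𝒩.S) (Γ : Set 𝒩.S) (h : FinalTrans T 𝒩 C s {s'} Γ) :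
      Shortcut T C y (.test 𝒩 s {s'} (.var y)) (pendingAtoms 𝒩 y Γ)

/-- `(u, r₁⁻, v)` is a transition for some `r₁` with `T ⊨ r ⊑ r₁`: a step from an `r`-successor to
its predecessor. -/
def StepUp {CN RN IN : Type} (T : TBox CN RN) (r : Role RN) (𝒩 : NNFA CN RN IN) (u v : 𝒩.S) :
    Prop :=
  ∃ r₁ : Role RN, EntailsT IN T (.ri r r₁) ∧ (u, Label.sym (Sym.role r₁.inv), v) ∈ 𝒩.delta

/-- `(v, r₂, v')` is a transition into `U` for some `r₂` with `T ⊨ r ⊑ r₂`: a step from a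
predecessor to an `r`-successor. -/
def StepDown {CN RN IN : Type} (T : TBox CN RN) (r : Role RN) (𝒩 : NNFA CN RN IN) (v : 𝒩.S)
    (U : Set 𝒩.S) : Prop :=
  ∃ r₂ : Role RN, EntailsT IN T (.ri r r₂) ∧
    ∃ v' ∈ U, (v, Label.sym (Sym.role r₂), v') ∈ 𝒩.delta

/-- Moving `y` from an `r`-successor to its predecessor. -/
inductive MoveUp {CN RN IN VN : Type} (T : TBox CN RN) (r : Role RN) (y : VN) :
    Atom CN RN IN VN → Atom CN RN IN VN → Prop
  | keep (α : Atom CN RN IN VN) (h : Term.var y ∉ α.terms) : MoveUp T r y α α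
  | source (𝒩 : NNFA CN RN IN) (u v : 𝒩.S) (U : Set 𝒩.S) (t : Term IN VN) (ht : t ≠ .var y)
      (hi : 𝒩.idx v = 𝒩.idx u) (h : StepUp T r 𝒩 u v) :
      MoveUp T r y (.role 𝒩 u U (.var y) t) (.role 𝒩 v U (.var y) t)
  | target (𝒩 : NNFA CN RN IN) (u v : 𝒩.S) (U : Set 𝒩.S) (t : Term IN VN) (ht : t ≠ .var y)
      (hi : 𝒩.idx v = 𝒩.idx u) (h : StepDown T r 𝒩 v U) :
      MoveUp T r y (.role 𝒩 u U t (.var y)) (.role 𝒩 u {v} t (.var y))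
  | both (𝒩 : NNFA CN RN IN) (u v v' : 𝒩.S) (U : Set 𝒩.S)
      (hi : 𝒩.idx v = 𝒩.idx u) (hi' : 𝒩.idx v' = 𝒩.idx u)
      (h : StepUp T r 𝒩 u v) (h' : StepDown T r 𝒩 v' U) :
      MoveUp T r y (.role 𝒩 u U (.var y) (.var y)) (.role 𝒩 v {v'} (.var y) (.var y))
  | test (𝒩 : NNFA CN RN IN) (u v : 𝒩.S) (U : Set 𝒩.S)
      (hi : 𝒩.idx v = 𝒩.idx u) (h : StepUp T r 𝒩 u v) :
      MoveUp T r y (.test 𝒩 u U (.var y)) (.test 𝒩 v U (.var y))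

/-- One iteration of the rewriting procedure turns `q` into `q'`. The nondeterministic choices are
the set `L` of quantified variables and `y ∈ L`; the conjunctions `C` and `D` of concept names
of `T`; the role `r`; and, for every atom, its decomposition `f₄`, the use of a jump or
final transition `f₅`, and the move to the predecessor `f₇`. -/
def OneStep {CN RN IN VN : Type} {k : ℕ} (T : TBox CN RN) (q q' : Query CN RN IN VN k) : Prop :=
  ∃ (L : Set VN) (y : VN) (C D : Finset CN) (r : Role RN)
    (f₄ f₅ : Atom CN RN IN VN → Set (Atom CN RN IN VN))
    (f₇ : Atom CN RN IN VN → Atom CN RN IN VN)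
    (q₂ q₃ q₄ q₅ : Set (Atom CN RN IN VN)),
    y ∈ L ∧ L ⊆ q.vars \ Set.range q.ans ∧
    q₂ = Atom.rename L y '' q.atoms ∧
    ↑C ⊆ T.names ∧
    (∀ B, Atom.concept B (.var y) ∈ q₂ → EntailsT IN T (.ci (.conj C) (.name B))) ∧
    q₃ = q₂ \ {α | ∃ B, α = .concept B (.var y)} ∧
    (∀ α ∈ q₃, Decompose y α (f₄ α)) ∧
    q₄ = (⋃ α ∈ q₃, f₄ α) ∧
    (∀ α ∈ q₄, Shortcut T C y α (f₅ α)) ∧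
    q₅ = (⋃ α ∈ q₄, f₅ α) ∧
    ↑D ⊆ T.names ∧
    EntailsT IN T (.ci (.conj D) (.ex r (.conj C))) ∧
    (∀ α ∈ q₅, MoveUp T r y α (f₇ α)) ∧
    q' = ⟨q.ans, (f₇ '' q₅) ∪ {α | ∃ A ∈ D, α = .concept A (.var y)}⟩

/-- All queries that can be obtained by an execution of the rewriting procedure on `q` and `T`. -/
def rewrite {CN RN IN VN : Type} {k : ℕ} (q : Query CN RN IN VN k) (T : TBox CN RN) :
    Set (Query CN RN IN VN k) :=
  {q' | Relation.ReflTransGen (OneStep T) q q'}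

/-- Some query of `rewrite q T` has a match in the canonical model that maps the answer
variables to the tuple `a` and every variable to an individual of the ABox. -/
def HasCoreMatch {CN RN IN VN : Type} {k : ℕ} (q : Query CN RN IN VN k) (T : TBox CN RN)
    (𝒜 : ABox CN RN IN) (a : Fin k → IN) : Prop :=
  ∃ q' ∈ rewrite q T, ∃ π : VN → (canModel T 𝒜).Dom,
    q'.IsMatch (canModel T 𝒜) π ∧
    (∀ i, (canModel T 𝒜).ind (a i) = some (π (q'.ans i))) ∧
    ∀ v ∈ q'.vars, ∃ b ∈ 𝒜.inds, (canModel T 𝒜).ind b = some (π v)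

end NestedQuery

/-!
The canonical model maps homomorphically into every model of the knowledge base
(`canModel_isHom`), so matches in it yield certain answers. In the other direction it is not itself
a model: an object `o r C` need not satisfy the concept inclusions that its predecessor `o` forces
on it. The generated model `genModel` keeps only the sequences in which every conjunction is a
maximal successor type over the names of the TBox. It satisfies the TBox (`genModel_satT`), is a
model of the ABox (`genModel_models`), and is a submodel of the canonical model. So a certain answer
has a match in the generated model.

A rewriting step moves the variables at some object `o = o' r C` to its predecessor `o'`. Soundness
(`OneStep.exists_isMatch`) reverses the move in the canonical model: if `o'` belongs to `D` and
`T ⊨ D ⊑ ∃r.C`, then the sequence `o' r C` exists; jump and final transitions give paths at that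
object because the canonical model of `{C(a)}` embeds below it.

Completeness (`exists_oneStep`) starts from a match in the generated model and takes for `o` an
object of maximal length in its image. The part below `o` is connected to the rest of the model only
through `o` and `o'`, and it corresponds to a part of the canonical model of `{C(a)}`. Hence a path
that meets it splits at its first exit (`Reach.first_exit`) and its last entry (`Reach.last_entry`)
into paths that stay below `o`, which are jump or final transitions, and paths that start with a
step from `o` to `o'` or end with a step from `o'` to `o`, which can be moved to `o'`
(`exists_decompose`). Nested runs that leave the part below `o` are cut off at `o`, and the states
where this happens form the set `Γ` of the transition (`pendingStates`). Iterating the step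
decreases the total length of the objects in the match until all variables are sent to individuals
(`hasCoreMatch_of_genModel`).
-/

namespace NestedQuery

variable {CN RN IN VN : Type}

/-! ### Roles, entailment and homomorphisms -/

@[simp] theorem Role.inv_inv (r : Role RN) : r.inv.inv = r := by cases r <;> rfl

theorem Interp.mem_role_inv (I : Interp CN RN IN) (r : Role RN) (d e : I.Dom) :
    (d, e) ∈ I.role r.inv ↔ (e, d) ∈ I.role r := by cases r <;> exact Iff.rfl

theorem EntailsT.ri_refl (T : TBox CN RN) (r : Role RN) : EntailsT IN T (.ri r r) :=
  fun _ _ => subset_rfl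

theorem EntailsT.ri_trans {T : TBox CN RN} {r r' r'' : Role RN}
    (h : EntailsT IN T (.ri r r')) (h' : EntailsT IN T (.ri r' r'')) :
    EntailsT IN T (.ri r r'') :=
  fun I hI => (h I hI).trans (h' I hI)

theorem EntailsT.ri_inv {T : TBox CN RN} {r r' : Role RN} (h : EntailsT IN T (.ri r r')) :
    EntailsT IN T (.ri r.inv r'.inv) := by
  rintro I hI ⟨d, e⟩ hde
  rw [Interp.mem_role_inv] at hde ⊢
  exact h I hI hde

theorem EntailsT.of_mem {T : TBox CN RN} {ax : TAxiom CN RN} (h : ax ∈ T) : EntailsT IN T ax :=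
  fun _ hI => hI.2 ax h

theorem EntailsT.ci_trans {T : TBox CN RN} {C D E : Concept CN RN}
    (h : EntailsT IN T (.ci C D)) (h' : EntailsT IN T (.ci D E)) : EntailsT IN T (.ci C E) :=
  fun I hI => (h I hI).trans (h' I hI)

/-- `I` satisfies the role inclusions entailed by `T`. -/
def Interp.ModelsRI (I : Interp CN RN IN) (T : TBox CN RN) : Prop :=
  ∀ r r', EntailsT IN T (.ri r r') → I.role r ⊆ I.role r'

/-- `h` preserves concept names, role names and the individuals in `N`. -/
structure Interp.IsHom (I I' : Interp CN RN IN) (N : Set IN) (h : I.Dom → I'.Dom) : Prop where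
  con : ∀ A d, d ∈ I.con A → h d ∈ I'.con A
  rol : ∀ p d e, (d, e) ∈ I.rol p → (h d, h e) ∈ I'.rol p
  ind : ∀ b ∈ N, ∀ d, I.ind b = some d → I'.ind b = some (h d)

namespace Interp.IsHom

variable {I I' I'' : Interp CN RN IN} {N : Set IN} {h : I.Dom → I'.Dom}

theorem comp {g : I'.Dom → I''.Dom} (hg : I'.IsHom I'' N g) (hh : I.IsHom I' N h) :
    I.IsHom I'' N (g ∘ h) where
  con A d hd := hg.con A _ (hh.con A d hd)
  rol p d e hd := hg.rol p _ _ (hh.rol p d e hd)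
  ind b hb d hd := hg.ind b hb _ (hh.ind b hb d hd)

theorem role (hh : I.IsHom I' N h) {r : Role RN} {d e : I.Dom} (hde : (d, e) ∈ I.role r) :
    (h d, h e) ∈ I'.role r := by
  cases r with
  | pos p => exact hh.rol p d e hde
  | neg p => exact hh.rol p e d hde

theorem sym (hh : I.IsHom I' N h) {σ : Sym CN RN IN} {d e : I.Dom}
    (hσ : ∀ b, σ = .testInd b → b ∈ N) (hde : (d, e) ∈ I.sym σ) : (h d, h e) ∈ I'.sym σ := by
  cases σ with
  | role r => exact hh.role hde
  | testInd b => exact ⟨congrArg h hde.1, hh.ind b (hσ b rfl) _ hde.2⟩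
  | testCon A => exact ⟨congrArg h hde.1, hh.con A _ hde.2⟩

theorem reach (hh : I.IsHom I' N h) {𝒩 : NNFA CN RN IN} (hN : 𝒩.inds ⊆ N) {d e : I.Dom}
    {s s' : 𝒩.S} (hr : Reach I 𝒩 d s e s') : Reach I' 𝒩 (h d) s (h e) s' := by
  induction hr with
  | refl o s => exact .refl _ _
  | sym hδ hσ _ ih =>
    refine .sym hδ (hh.sym ?_ hσ) ih
    rintro b rfl
    exact hN ⟨_, _, hδ⟩
  | nest hδ _ hf _ ih₁ ih₂ => exact .nest hδ ih₁ hf ih₂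

theorem term (hh : I.IsHom I' N h) {π : VN → I.Dom} {t : Term IN VN}
    (ht : ∀ b, t = .ind b → b ∈ N) {d : I.Dom} (hd : I.term π t = some d) :
    I'.term (h ∘ π) t = some (h d) := by
  cases t with
  | var v => simpa [Interp.term] using congrArg (Option.map h) hd
  | ind b => exact hh.ind b (ht b rfl) d hd

theorem satAtom (hh : I.IsHom I' N h) {π : VN → I.Dom} {α : Atom CN RN IN VN}
    (hα : α.inds ⊆ N) (hs : I.SatAtom π α) : I'.SatAtom (h ∘ π) α := by
  cases α with
  | concept A t =>
    obtain ⟨d, hd, hA⟩ := hs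
    exact ⟨h d, hh.term (fun b hb => hα (by subst hb; simp [Atom.inds, Atom.terms])) hd,
      hh.con A d hA⟩
  | role 𝒩 s F t t' =>
    obtain ⟨d, e, hd, he, f, hf, hr⟩ := hs
    exact ⟨h d, h e, hh.term (fun b hb => hα (by subst hb; simp [Atom.inds, Atom.terms])) hd,
      hh.term (fun b hb => hα (by subst hb; simp [Atom.inds, Atom.terms])) he, f, hf,
      hh.reach (fun b hb => hα (Or.inr hb)) hr⟩
  | test 𝒩 s F t =>
    obtain ⟨d, e, hd, f, hf, hr⟩ := hs
    exact ⟨h d, h e, hh.term (fun b hb => hα (by subst hb; simp [Atom.inds, Atom.terms])) hd,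
      f, hf, hh.reach (fun b hb => hα (Or.inr hb)) hr⟩

end Interp.IsHom

theorem Reach.trans {I : Interp CN RN IN} {𝒩 : NNFA CN RN IN} {d e e' : I.Dom}
    {s s' s'' : 𝒩.S} (h : Reach I 𝒩 d s e s') (h' : Reach I 𝒩 e s' e' s'') :
    Reach I 𝒩 d s e' s'' := by
  induction h with
  | refl => exact h'
  | sym hδ hσ _ ih => exact .sym hδ hσ (ih h')
  | nest hδ hj hf _ _ ih => exact .nest hδ hj hf (ih h')

theorem Reach.idx_eq {I : Interp CN RN IN} {𝒩 : NNFA CN RN IN} {d e : I.Dom} {s s' : 𝒩.S}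
    (h : Reach I 𝒩 d s e s') : 𝒩.idx s = 𝒩.idx s' := by
  induction h with
  | refl => rfl
  | sym hδ _ _ ih => exact (𝒩.idx_delta _ _ _ hδ).trans ih
  | nest hδ _ _ _ _ ih => exact (𝒩.idx_delta _ _ _ hδ).trans ih

theorem NNFA.finite_inds (𝒩 : NNFA CN RN IN) : 𝒩.inds.Finite := by
  have h := (𝒩.finite_delta.image (fun x => x.2.1)).preimage
    (f := fun a => (Label.sym (Sym.testInd a) : Label CN RN IN 𝒩.n))
    (fun a _ b _ hab => by simpa using hab)
  exact h.subset fun a ⟨s, s', hs⟩ => ⟨_, hs, rfl⟩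

/-! ### Roles between the objects of a canonical model -/

/-- `CanRol`, extended to inverse roles. -/
def PathRole (T : TBox CN RN) (𝒜 : ABox CN RN IN) :
    Role RN → IN × List (Role RN × Finset CN) → IN × List (Role RN × Finset CN) → Prop
  | .pos p, o, o' => CanRol T 𝒜 p o o'
  | .neg p, o, o' => CanRol T 𝒜 p o' o

theorem pathRole_iff {T : TBox CN RN} {𝒜 : ABox CN RN IN} {r : Role RN}
    {o o' : IN × List (Role RN × Finset CN)} :
    PathRole T 𝒜 r o o' ↔
      (o.2 = [] ∧ o'.2 = [] ∧ ∃ r', Assertion.role r' o.1 o'.1 ∈ 𝒜 ∧ EntailsT IN T (.ri r' r)) ∨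
      (o.2 = [] ∧ o'.2 = [] ∧
        ∃ r', Assertion.role r' o'.1 o.1 ∈ 𝒜 ∧ EntailsT IN T (.ri r' r.inv)) ∨
      (∃ r' C, o' = (o.1, (r', C) :: o.2) ∧ EntailsT IN T (.ri r' r)) ∨
      (∃ r' C, o = (o'.1, (r', C) :: o'.2) ∧ EntailsT IN T (.ri r' r.inv)) := by
  cases r with
  | pos p => exact Iff.rfl
  | neg p =>
    constructor
    · rintro (⟨h, h', h''⟩ | ⟨h, h', h''⟩ | h | h)
      exacts [.inr (.inl ⟨h', h, h''⟩), .inl ⟨h', h, h''⟩, .inr (.inr (.inr h)),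
        .inr (.inr (.inl h))]
    · rintro (⟨h, h', h''⟩ | ⟨h, h', h''⟩ | h | h)
      exacts [.inr (.inl ⟨h', h, h''⟩), .inl ⟨h', h, h''⟩, .inr (.inr (.inr h)),
        .inr (.inr (.inl h))]

theorem canModel_role {T : TBox CN RN} {𝒜 : ABox CN RN IN} {r : Role RN}
    {x x' : (canModel T 𝒜).Dom} :
    (x, x') ∈ (canModel T 𝒜).role r ↔ PathRole T 𝒜 r x.1 x'.1 := by cases r <;> exact Iff.rfl

theorem canModel_ind {T : TBox CN RN} {𝒜 : ABox CN RN IN} {b : IN} {x : (canModel T 𝒜).Dom} :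
    (canModel T 𝒜).ind b = some x ↔ x.1 = (b, []) := by
  obtain ⟨⟨a, l⟩, hx⟩ := x
  by_cases hb : b ∈ 𝒜.inds
  · simp only [canModel, hb, dite_true, Option.some.injEq]
    exact Subtype.mk_eq_mk.trans eq_comm
  · simp only [canModel, hb, dite_false, reduceCtorEq, false_iff]
    rintro h
    obtain ⟨rfl, rfl⟩ := Prod.mk.inj h
    exact hb hx

theorem ValidPath.tail {T : TBox CN RN} {𝒜 : ABox CN RN IN} {a : IN}
    {c : Role RN × Finset CN} {l : List (Role RN × Finset CN)} (h : ValidPath T 𝒜 a (c :: l)) :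
    ValidPath T 𝒜 a l := by
  obtain ⟨r, C⟩ := c
  cases l with
  | nil => exact h.1
  | cons c' l => exact h.2

/-! ### The canonical model maps into every model -/

open Classical in
/-- The image of an object of the canonical model in a model `I`: successors are chosen one after
the other along the path, as long as there are any. -/
noncomputable def pathImage (I : Interp CN RN IN) (hI : I.Proper) (a : IN) :
    List (Role RN × Finset CN) → I.Dom
  | [] => (hI.2 a).choose
  | (r, C) :: l =>
      if h : ∃ e, (pathImage I hI a l, e) ∈ I.role r ∧ e ∈ I.concept (.conj C) then h.choose
      else pathImage I hI a l

theorem ind_eq_pathImage (I : Interp CN RN IN) (hI : I.Proper) (a : IN) :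
    I.ind a = some (pathImage I hI a []) :=
  (hI.2 a).choose_spec

theorem EntailsA.mem_concept {T : TBox CN RN} {𝒜 : ABox CN RN IN} {C : Concept CN RN} {a : IN}
    (h : EntailsA T 𝒜 (.concept C a)) {I : Interp CN RN IN} (hI : I.Models T 𝒜) {d : I.Dom}
    (hd : I.ind a = some d) : d ∈ I.concept C := by
  obtain ⟨d', hd', hC⟩ := h I hI
  rw [hd] at hd'
  cases hd'
  exact hC

theorem pathImage_cons {T : TBox CN RN} {𝒜 : ABox CN RN IN} {I : Interp CN RN IN}
    (hI : I.Models T 𝒜) (a : IN) (l : List (Role RN × Finset CN)) :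
    ∀ (r : Role RN) (C : Finset CN), ValidPath T 𝒜 a ((r, C) :: l) →
      (pathImage I hI.1.1 a l, pathImage I hI.1.1 a ((r, C) :: l)) ∈ I.role r ∧
        pathImage I hI.1.1 a ((r, C) :: l) ∈ I.concept (.conj C) := by
  have key : ∀ (l : List (Role RN × Finset CN)) (r : Role RN) (C : Finset CN),
      (∃ e, (pathImage I hI.1.1 a l, e) ∈ I.role r ∧ e ∈ I.concept (.conj C)) →
      (pathImage I hI.1.1 a l, pathImage I hI.1.1 a ((r, C) :: l)) ∈ I.role r ∧
        pathImage I hI.1.1 a ((r, C) :: l) ∈ I.concept (.conj C) := by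
    intro l r C h
    rw [pathImage, dif_pos h]
    exact h.choose_spec
  induction l with
  | nil =>
    intro r C h
    exact key _ _ _ (h.2.mem_concept hI (ind_eq_pathImage I hI.1.1 a))
  | cons c l ih =>
    obtain ⟨r', C'⟩ := c
    intro r C h
    exact key _ _ _ (h.1 I hI.1 (ih r' C' h.2).2)

theorem canModel_isHom {T : TBox CN RN} {𝒜 : ABox CN RN IN} {I : Interp CN RN IN}
    (hI : I.Models T 𝒜) :
    (canModel T 𝒜).IsHom I Set.univ (fun x => pathImage I hI.1.1 x.1.1 x.1.2) where
  con := by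
    rintro A ⟨⟨a, _ | ⟨⟨r, C⟩, l⟩⟩, hx⟩ hA
    · exact EntailsA.mem_concept hA hI (ind_eq_pathImage I hI.1.1 a)
    · exact hA I hI.1 (pathImage_cons hI a l r C hx).2
  rol := by
    rintro p ⟨⟨a, l⟩, hx⟩ ⟨⟨b, m⟩, hy⟩ h
    have hab : ∀ a b r, Assertion.role r a b ∈ 𝒜 →
        (pathImage I hI.1.1 a [], pathImage I hI.1.1 b []) ∈ I.role r := by
      intro a b r hr
      obtain ⟨d, e, hd, he, hde⟩ := hI.2 _ hr
      rw [ind_eq_pathImage I hI.1.1, Option.some.injEq] at hd he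
      rwa [hd, he]
    rcases h with ⟨h₁, h₂, r, hr, hT⟩ | ⟨h₁, h₂, r, hr, hT⟩ | ⟨r, C, h, hT⟩ | ⟨r, C, h, hT⟩
    · dsimp only at h₁ h₂ hr ⊢
      subst h₁ h₂
      exact hT I hI.1 (hab _ _ _ hr)
    · dsimp only at h₁ h₂ hr ⊢
      subst h₁ h₂
      exact hT I hI.1 (hab _ _ _ hr)
    · dsimp only at h
      obtain ⟨rfl, rfl⟩ := Prod.mk.inj h
      exact hT I hI.1 (pathImage_cons hI b l r C hy).1
    · dsimp only at h
      obtain ⟨rfl, rfl⟩ := Prod.mk.inj h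
      exact hT I hI.1 (pathImage_cons hI a m r C hx).1
  ind := by
    intro b _ x hx
    rw [ind_eq_pathImage I hI.1.1, canModel_ind.1 hx]

/-! ### The generated model -/

theorem Concept.finite_names (C : Concept CN RN) : C.names.Finite := by
  induction C with
  | top => exact Set.finite_empty
  | bot => exact Set.finite_empty
  | name A => exact Set.finite_singleton A
  | ex r C ih => exact ih
  | inf C D ih ih' => exact ih.union ih'

theorem TBox.finite_names (T : TBox CN RN) : (TBox.names T).Finite := by
  have h : TBox.names T = ⋃ ax ∈ T, ax.names := by ext A; simp [TBox.names]
  rw [h]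
  refine T.finite_toSet.biUnion fun ax _ => ?_
  cases ax with
  | ci C D => exact C.finite_names.union D.finite_names
  | ri => exact Set.finite_empty
  | nri => exact Set.finite_empty

/-- The conjunction of names of `T` that describes an object of the canonical model: for an
individual, all its entailed names; for a longer sequence, the last conjunction. -/
noncomputable def lastConj (T : TBox CN RN) (𝒜 : ABox CN RN IN) (a : IN) :
    List (Role RN × Finset CN) → Finset CN
  | [] => (T.finite_names.subset
      (Set.sep_subset T.names fun A => EntailsA T 𝒜 (.concept (.name A) a))).toFinset
  | (_, C) :: _ => C

theorem mem_lastConj_nil {T : TBox CN RN} {𝒜 : ABox CN RN IN} {a : IN} {A : CN} :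
    A ∈ lastConj T 𝒜 a [] ↔ A ∈ T.names ∧ EntailsA T 𝒜 (.concept (.name A) a) := by
  simp [lastConj]

/-- `C` is a maximal conjunction of names of `T` with `T ⊨ D ⊑ ∃r.C`. -/
def IsMaxSucc (IN : Type) (T : TBox CN RN) (D : Finset CN) (r : Role RN) (C : Finset CN) : Prop :=
  Maximal (· ∈ {C : Finset CN | ↑C ⊆ T.names ∧ EntailsT IN T (.ci (.conj D) (.ex r (.conj C)))}) C

theorem exists_isMaxSucc {T : TBox CN RN} {D C : Finset CN} {r : Role RN} (hC : ↑C ⊆ T.names)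
    (h : EntailsT IN T (.ci (.conj D) (.ex r (.conj C)))) :
    ∃ C', C ⊆ C' ∧ IsMaxSucc IN T D r C' := by
  refine Set.Finite.exists_le_maximal
    ((T.finite_names.toFinset.powerset.finite_toSet).subset ?_) ⟨hC, h⟩
  rintro E ⟨hE, -⟩
  simpa [Finset.subset_iff, Set.subset_def] using hE

/-- The sequences in which every conjunction is a maximal successor type of the preceding
object. -/
def GenPath (T : TBox CN RN) (𝒜 : ABox CN RN IN) (a : IN) :
    List (Role RN × Finset CN) → Prop
  | [] => a ∈ 𝒜.inds
  | (r, C) :: l => IsMaxSucc IN T (lastConj T 𝒜 a l) r C ∧ GenPath T 𝒜 a l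

open Classical in
/-- The generated model: the canonical model restricted to maximal successor types. The canonical
model itself may violate an inclusion `∃r.B ⊑ A` at a sequence `o r⁻ C` with `o ∈ B`, because
`T ⊨ C ⊑ A` need not hold; with maximal `C` this cannot happen. -/
noncomputable def genModel (T : TBox CN RN) (𝒜 : ABox CN RN IN) : Interp CN RN IN where
  Dom := {o : IN × List (Role RN × Finset CN) // GenPath T 𝒜 o.1 o.2}
  ind := fun a => if h : a ∈ 𝒜.inds then some ⟨(a, []), h⟩ else none
  con := fun A => {o | CanCon T 𝒜 A o.1}
  rol := fun p => {x | CanRol T 𝒜 p x.1.1 x.2.1}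

variable {T : TBox CN RN} {𝒜 : ABox CN RN IN}

theorem genModel_role {r : Role RN} {x x' : (genModel T 𝒜).Dom} :
    (x, x') ∈ (genModel T 𝒜).role r ↔ PathRole T 𝒜 r x.1 x'.1 := by cases r <;> exact Iff.rfl

theorem genModel_ind {b : IN} {x : (genModel T 𝒜).Dom} :
    (genModel T 𝒜).ind b = some x ↔ x.1 = (b, []) := by
  obtain ⟨⟨a, l⟩, hx⟩ := x
  by_cases hb : b ∈ 𝒜.inds
  · simp only [genModel, hb, dite_true, Option.some.injEq]
    exact Subtype.mk_eq_mk.trans eq_comm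
  · simp only [genModel, hb, dite_false, reduceCtorEq, false_iff]
    rintro h
    obtain ⟨rfl, rfl⟩ := Prod.mk.inj h
    exact hb hx

theorem entailsA_of_lastConj {a : IN} {D : Concept CN RN}
    (h : EntailsT IN T (.ci (.conj (lastConj T 𝒜 a [])) D)) : EntailsA T 𝒜 (.concept D a) := by
  intro I hI
  obtain ⟨d, hd⟩ := hI.1.1.2 a
  refine ⟨d, hd, h I hI.1 ((I.mem_conj _ _).2 fun A hA => ?_)⟩
  exact (mem_lastConj_nil.1 hA).2.mem_concept hI hd

theorem canCon_of_lastConj {a : IN} {l : List (Role RN × Finset CN)} {A : CN}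
    (h : EntailsT IN T (.ci (.conj (lastConj T 𝒜 a l)) (.name A))) : CanCon T 𝒜 A (a, l) := by
  cases l with
  | nil => exact entailsA_of_lastConj h
  | cons c l => exact h

theorem entailsT_of_mem_conj {C : Finset CN} {A : CN} (h : A ∈ C) :
    EntailsT IN T (.ci (.conj C) (.name A)) :=
  fun I _ d hd => (I.mem_conj C d).1 hd A h

theorem CanCon.entails_lastConj {a : IN} {l : List (Role RN × Finset CN)} {A : CN}
    (h : CanCon T 𝒜 A (a, l)) (hA : A ∈ T.names) :
    EntailsT IN T (.ci (.conj (lastConj T 𝒜 a l)) (.name A)) := by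
  cases l with
  | nil => exact entailsT_of_mem_conj (mem_lastConj_nil.2 ⟨hA, h⟩)
  | cons c l => exact h

theorem GenPath.validPath {a : IN} {l : List (Role RN × Finset CN)} (h : GenPath T 𝒜 a l) :
    ValidPath T 𝒜 a l := by
  induction l with
  | nil => exact h
  | cons c l ih =>
    obtain ⟨r, C⟩ := c
    cases l with
    | nil => exact ⟨h.2, entailsA_of_lastConj h.1.1.2⟩
    | cons c' l => exact ⟨h.1.1.2, ih h.2⟩

theorem genModel_isHom :
    (genModel T 𝒜).IsHom (canModel T 𝒜) Set.univ (fun x => ⟨x.1, x.2.validPath⟩) where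
  con _ _ h := h
  rol _ _ _ h := h
  ind _ _ _ h := canModel_ind.2 (genModel_ind.1 h)

theorem genModel_satT (hT : T.IsNormal) (hcons : Consistent T 𝒜) :
    ∀ ax ∈ T, (genModel T 𝒜).SatT ax := by
  classical
  obtain ⟨I, hI⟩ := hcons
  have hom := (canModel_isHom hI).comp genModel_isHom
  intro ax hax
  have hn := hT ax hax
  cases hn with
  | bot A =>
    intro x hx
    exact (hI.1.2 _ hax (hom.con A x hx)).elim
  | ex A r B =>
    rintro ⟨⟨a, l⟩, hx⟩ hA
    have hB : ↑({B} : Finset CN) ⊆ T.names := by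
      intro B' hB'
      obtain rfl : B' = B := by simpa using hB'
      exact ⟨_, hax, Or.inr rfl⟩
    have h₁ := (CanCon.entails_lastConj hA ⟨_, hax, Or.inl rfl⟩).ci_trans (EntailsT.of_mem hax)
    have h₂ : EntailsT IN T (.ci (.conj (lastConj T 𝒜 a l)) (.ex r (.conj {B}))) := by
      intro J hJ d hd
      obtain ⟨e, he, heB⟩ := h₁ J hJ hd
      exact ⟨e, he, (J.mem_conj _ _).2 (by simpa [Interp.concept] using heB)⟩
    obtain ⟨C, hBC, hC⟩ := exists_isMaxSucc hB h₂
    refine ⟨⟨(a, (r, C) :: l), hC, hx⟩, ?_, ?_⟩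
    · exact genModel_role.2 (pathRole_iff.2 (.inr (.inr (.inl ⟨r, C, rfl, .ri_refl T r⟩))))
    · exact canCon_of_lastConj (𝒜 := 𝒜) (a := a) (l := (r, C) :: l)
        (entailsT_of_mem_conj (hBC (Finset.mem_singleton_self B)))
  | top A =>
    rintro ⟨⟨a, l⟩, hx⟩ -
    exact canCon_of_lastConj fun J hJ d _ => hJ.2 _ hax (Set.mem_univ d)
  | inf B₁ B₂ A =>
    rintro ⟨⟨a, l⟩, hx⟩ ⟨h₁, h₂⟩
    have h₁ := CanCon.entails_lastConj h₁ ⟨_, hax, Or.inl (Or.inl rfl)⟩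
    have h₂ := CanCon.entails_lastConj h₂ ⟨_, hax, Or.inl (Or.inr rfl)⟩
    exact canCon_of_lastConj fun J hJ d hd => hJ.2 _ hax ⟨h₁ J hJ hd, h₂ J hJ hd⟩
  | exl r B A =>
    have hB : B ∈ T.names := ⟨_, hax, Or.inl rfl⟩
    have hA : A ∈ T.names := ⟨_, hax, Or.inr rfl⟩
    rintro ⟨⟨a, l⟩, hx⟩ ⟨⟨⟨b, m⟩, hy⟩, hxy, hyB⟩
    replace hxy := pathRole_iff.1 (genModel_role.1 hxy)
    dsimp only at hxy
    have ind_case : ∀ r' : Role RN, (∀ J : Interp CN RN IN, J.Models T 𝒜 → ∃ d e,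
        J.ind a = some d ∧ J.ind b = some e ∧ (d, e) ∈ J.role r) → l = [] → m = [] →
        CanCon T 𝒜 A (a, l) := by
      rintro r' h rfl rfl J hJ
      obtain ⟨d, e, hd, he, hde⟩ := h J hJ
      exact ⟨d, hd, hJ.1.2 _ hax ⟨e, hde, EntailsA.mem_concept hyB hJ he⟩⟩
    rcases hxy with ⟨h₁, h₂, r', hr, hT'⟩ | ⟨h₁, h₂, r', hr, hT'⟩ | ⟨r', C, h, hT'⟩ |
      ⟨r', C, h, hT'⟩
    · refine ind_case r' (fun J hJ => ?_) h₁ h₂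
      obtain ⟨d, e, hd, he, hde⟩ := hJ.2 _ hr
      exact ⟨d, e, hd, he, hT' J hJ.1 hde⟩
    · refine ind_case r' (fun J hJ => ?_) h₁ h₂
      obtain ⟨d, e, hd, he, hde⟩ := hJ.2 _ hr
      exact ⟨e, d, he, hd, (J.mem_role_inv r d e).1 (hT' J hJ.1 hde)⟩
    · obtain ⟨rfl, rfl⟩ := Prod.mk.inj h
      refine canCon_of_lastConj fun J hJ d hd => ?_
      obtain ⟨e, he, heC⟩ := hy.1.1.2 J hJ hd
      exact hJ.2 _ hax ⟨e, hT' J hJ he, hyB J hJ heC⟩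
    · obtain ⟨rfl, rfl⟩ := Prod.mk.inj h
      -- The predecessor lies in `B`, so its `r'`-successors satisfy `A` as well, and `A` belongs
      -- to the maximal conjunction `C`.
      have hBm := CanCon.entails_lastConj hyB hB
      have hmax : insert A C ⊆ C := by
        refine hx.1.2 ⟨?_, fun J hJ d hd => ?_⟩ (Finset.subset_insert A C)
        · rw [Finset.coe_insert]
          exact Set.insert_subset hA hx.1.1.1
        · obtain ⟨e, he, heC⟩ := hx.1.1.2 J hJ hd
          refine ⟨e, he, (J.mem_conj _ _).2 fun A' hA' => ?_⟩
          rcases Finset.mem_insert.1 hA' with rfl | hA'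
          · exact hJ.2 _ hax ⟨d, (J.mem_role_inv r d e).1 (hT' J hJ he), hBm J hJ hd⟩
          · exact (J.mem_conj _ _).1 heC A' hA'
      exact canCon_of_lastConj (𝒜 := 𝒜) (a := a) (l := (r', C) :: m)
        (entailsT_of_mem_conj (hmax (Finset.mem_insert_self A C)))
  | ri r r' =>
    rintro ⟨x, y⟩ hxy
    have hr : EntailsT IN T (.ri r r') := .of_mem hax
    rw [genModel_role, pathRole_iff] at hxy ⊢
    rcases hxy with ⟨h₁, h₂, r₁, hr₁, h⟩ | ⟨h₁, h₂, r₁, hr₁, h⟩ | ⟨r₁, C, h₁, h⟩ | ⟨r₁, C, h₁, h⟩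
    · exact .inl ⟨h₁, h₂, r₁, hr₁, h.ri_trans hr⟩
    · exact .inr (.inl ⟨h₁, h₂, r₁, hr₁, h.ri_trans hr.ri_inv⟩)
    · exact .inr (.inr (.inl ⟨r₁, C, h₁, h.ri_trans hr⟩))
    · exact .inr (.inr (.inr ⟨r₁, C, h₁, h.ri_trans hr.ri_inv⟩))
  | nri r r' =>
    refine Set.eq_empty_of_forall_notMem ?_
    rintro ⟨x, y⟩ ⟨h, h'⟩
    exact (hI.1.2 _ hax).le ⟨hom.role h, hom.role h'⟩

/-- The interpretation `I` with the individuals reinterpreted by `f`. -/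
def Interp.withInd (I : Interp CN RN IN) (f : IN → Option I.Dom) : Interp CN RN IN :=
  { I with ind := f }

theorem Interp.withInd_role (I : Interp CN RN IN) (f : IN → Option I.Dom) (r : Role RN) :
    (I.withInd f).role r = I.role r := by cases r <;> rfl

theorem Interp.withInd_concept (I : Interp CN RN IN) (f : IN → Option I.Dom)
    (C : Concept CN RN) : (I.withInd f).concept C = I.concept C := by
  induction C with
  | top => rfl
  | bot => rfl
  | name A => rfl
  | ex r C ih => simp only [Interp.concept, ih, Interp.withInd_role]; rfl
  | inf C D ih ih' => simp only [Interp.concept, ih, ih']; rfl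

theorem Interp.withInd_satT (I : Interp CN RN IN) (f : IN → Option I.Dom) (ax : TAxiom CN RN) :
    (I.withInd f).SatT ax ↔ I.SatT ax := by
  cases ax <;> simp only [Interp.SatT, Interp.withInd_role, Interp.withInd_concept] <;> exact Iff.rfl

theorem genModel_concept_of_isConj {a : IN} (ha : a ∈ 𝒜.inds) (C : Concept CN RN)
    (hC : C.IsConj) (h : EntailsA T 𝒜 (.concept C a)) :
    (⟨(a, []), ha⟩ : (genModel T 𝒜).Dom) ∈ (genModel T 𝒜).concept C := by
  induction C with
  | top => exact Set.mem_univ _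
  | bot => exact hC.elim
  | name A => exact h
  | ex r C ih => exact hC.elim
  | inf C D ih ih' =>
    refine ⟨ih hC.1 fun I hI => ?_, ih' hC.2 fun I hI => ?_⟩
    · obtain ⟨d, hd, hd'⟩ := h I hI
      exact ⟨d, hd, hd'.1⟩
    · obtain ⟨d, hd, hd'⟩ := h I hI
      exact ⟨d, hd, hd'.2⟩

open Classical in
/-- The generated model becomes a model of the knowledge base once the individuals outside the
ABox are interpreted, all by the same individual `b` of the ABox. -/
theorem genModel_models (hT : T.IsNormal) (h𝒜 : 𝒜.IsNormal) (hcons : Consistent T 𝒜)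
    {b : IN} (hb : b ∈ 𝒜.inds) :
    ((genModel T 𝒜).withInd fun a =>
      if a ∈ 𝒜.inds then (genModel T 𝒜).ind a else (genModel T 𝒜).ind b).Models T 𝒜 := by
  have hind : ∀ a (ha : a ∈ 𝒜.inds), (genModel T 𝒜).ind a = some ⟨(a, []), ha⟩ :=
    fun a ha => genModel_ind.2 rfl
  refine ⟨⟨⟨⟨⟨(b, []), hb⟩⟩, fun a => ?_⟩, fun ax hax => ?_⟩, fun as has => ?_⟩
  · by_cases ha : a ∈ 𝒜.inds
    · exact ⟨⟨(a, []), ha⟩, (if_pos ha).trans (hind a ha)⟩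
    · exact ⟨⟨(b, []), hb⟩, (if_neg ha).trans (hind b hb)⟩
  · exact (Interp.withInd_satT _ _ _).2 (genModel_satT hT hcons ax hax)
  · cases as with
    | concept C a =>
      have ha : a ∈ 𝒜.inds := ⟨_, has, rfl⟩
      refine ⟨⟨(a, []), ha⟩, (if_pos ha).trans (hind a ha), ?_⟩
      rw [Interp.withInd_concept]
      exact genModel_concept_of_isConj ha C (h𝒜 C a has) fun I hI => hI.2 _ has
    | role r a c =>
      have ha : a ∈ 𝒜.inds := ⟨_, has, Or.inl rfl⟩
      have hc : c ∈ 𝒜.inds := ⟨_, has, Or.inr rfl⟩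
      refine ⟨⟨(a, []), ha⟩, ⟨(c, []), hc⟩, (if_pos ha).trans (hind a ha),
        (if_pos hc).trans (hind c hc), ?_⟩
      rw [Interp.withInd_role]
      exact genModel_role.2 (pathRole_iff.2 (.inl ⟨rfl, rfl, r, has, .ri_refl T r⟩))

theorem certainAnswer_of_canModel {k : ℕ} {q : Query CN RN IN VN k} {a : Fin k → IN}
    {π : VN → (canModel T 𝒜).Dom} (hπ : q.IsMatch (canModel T 𝒜) π)
    (ha : ∀ i, (canModel T 𝒜).ind (a i) = some (π (q.ans i))) : q.CertainAnswer T 𝒜 a := by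
  intro I hI
  have hom := canModel_isHom hI
  exact ⟨_, fun α hα => hom.satAtom (Set.subset_univ _) (hπ α hα),
    fun i => hom.ind _ (Set.mem_univ _) _ (ha i)⟩

theorem Query.CertainAnswer.exists_genModel {k : ℕ} {q : Query CN RN IN VN k} {a : Fin k → IN}
    (hT : T.IsNormal) (h𝒜 : 𝒜.IsNormal) (hne : 𝒜.Nonempty) (hcons : Consistent T 𝒜)
    (hqi : q.inds ⊆ 𝒜.inds) (ha : ∀ i, a i ∈ 𝒜.inds) (h : q.CertainAnswer T 𝒜 a) :
    ∃ π : VN → (genModel T 𝒜).Dom, q.IsMatch (genModel T 𝒜) π ∧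
      ∀ i, (genModel T 𝒜).ind (a i) = some (π (q.ans i)) := by
  classical
  obtain ⟨b, hb⟩ : ∃ b, b ∈ 𝒜.inds := by
    obtain ⟨as, has⟩ := hne
    cases as with
    | concept C b => exact ⟨b, _, has, rfl⟩
    | role r b c => exact ⟨b, _, has, Or.inl rfl⟩
  obtain ⟨π, hπ, hans⟩ := h _ (genModel_models hT h𝒜 hcons hb)
  have hom : Interp.IsHom ((genModel T 𝒜).withInd fun a =>
      if a ∈ 𝒜.inds then (genModel T 𝒜).ind a else (genModel T 𝒜).ind b)
      (genModel T 𝒜) 𝒜.inds id :=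
    ⟨fun _ _ h => h, fun _ _ _ h => h, fun c hc d hd => (if_pos hc).symm.trans hd⟩
  exact ⟨π, fun α hα => hom.satAtom (fun c hc => hqi ⟨α, hα, hc⟩) (hπ α hα),
    fun i => hom.ind _ (ha i) _ (hans i)⟩

/-! ### The canonical model of a single concept assertion -/

theorem inds_singleton_concept {C : Concept CN RN} {a b : IN} :
    b ∈ ABox.inds ({.concept C a} : ABox CN RN IN) ↔ b = a := by
  simp [ABox.inds, Assertion.inds]

theorem entailsA_singleton_iff {C D : Concept CN RN} {a : IN} :
    EntailsA T {.concept C a} (.concept D a) ↔ EntailsT IN T (.ci C D) := by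
  classical
  constructor
  · intro h I hI d hd
    have ha : (I.withInd (Function.update I.ind a (some d))).ind a = some d :=
      by simp [Interp.withInd]
    have hM : (I.withInd (Function.update I.ind a (some d))).Models T {.concept C a} := by
      refine ⟨⟨⟨hI.1.1, fun b => ?_⟩, fun ax hax => (I.withInd_satT _ ax).2 (hI.2 ax hax)⟩, ?_⟩
      · by_cases hb : b = a
        · subst hb
          exact ⟨d, ha⟩
        · obtain ⟨e, he⟩ := hI.1.2 b
          exact ⟨e, (Function.update_of_ne hb ..).trans he⟩
      · intro as has
        rw [Finset.mem_singleton.1 has]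
        refine ⟨d, ha, ?_⟩
        rwa [Interp.withInd_concept]
    have := h.mem_concept hM ha
    rwa [Interp.withInd_concept] at this
  · intro h I hI
    obtain ⟨d, hd, hC⟩ := hI.2 _ (Finset.mem_singleton_self _)
    exact ⟨d, hd, h I hI.1 hC⟩

theorem ValidPath.mem_inds {a : IN} {l : List (Role RN × Finset CN)} (h : ValidPath T 𝒜 a l) :
    a ∈ 𝒜.inds := by
  induction l with
  | nil => exact h
  | cons c l ih => exact ih h.tail

theorem ValidPath.append {a a₀ : IN} {r : Role RN} {C : Finset CN}
    {l m : List (Role RN × Finset CN)} (ho : ValidPath T 𝒜 a₀ ((r, C) :: l))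
    (h : ValidPath T {.concept (.conj C) a} a m) : ValidPath T 𝒜 a₀ (m ++ (r, C) :: l) := by
  induction m with
  | nil => exact ho
  | cons c m ih =>
    obtain ⟨r', C'⟩ := c
    cases m with
    | nil => exact ⟨entailsA_singleton_iff.1 h.2, ho⟩
    | cons c' m => exact ⟨h.1, ih h.2⟩

/-- The canonical model of `{C(a)}` embeds into the part of a canonical model below an object with
last conjunction `C`. -/
theorem canModel_singleton_isHom {a a₀ : IN} {r : Role RN} {C : Finset CN}
    {l : List (Role RN × Finset CN)} (ho : ValidPath T 𝒜 a₀ ((r, C) :: l)) :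
    (canModel T {.concept (.conj C) a}).IsHom (canModel T 𝒜) {a}ᶜ
      (fun z => ⟨(a₀, z.1.2 ++ (r, C) :: l),
        ho.append (by have := z.2; rwa [inds_singleton_concept.1 z.2.mem_inds] at this)⟩) where
  con := by
    rintro A ⟨⟨b, m⟩, hz⟩ hA
    obtain rfl : b = a := inds_singleton_concept.1 hz.mem_inds
    cases m with
    | nil => exact entailsA_singleton_iff.1 hA
    | cons c m => exact hA
  rol := by
    rintro p ⟨⟨b, m⟩, hz⟩ ⟨⟨b', m'⟩, hz'⟩ h
    rcases h with ⟨-, -, r', hr, -⟩ | ⟨-, -, r', hr, -⟩ | ⟨r', C', h, hT⟩ | ⟨r', C', h, hT⟩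
    · simp at hr
    · simp at hr
    · dsimp only at h
      obtain ⟨rfl, rfl⟩ := Prod.mk.inj h
      exact .inr (.inr (.inl ⟨r', C', rfl, hT⟩))
    · dsimp only at h
      obtain ⟨rfl, rfl⟩ := Prod.mk.inj h
      exact .inr (.inr (.inr ⟨r', C', rfl, hT⟩))
  ind := by
    intro b hb z hz
    have h := z.2.mem_inds
    rw [canModel_ind.1 hz] at h
    exact (hb (inds_singleton_concept.1 h)).elim

/-! ### Reading off paths from partial runs -/

/-- From `(d, s)`, the automaton of `s` can reach one of its final states. -/
def Accepts (I : Interp CN RN IN) (𝒩 : NNFA CN RN IN) (d : I.Dom) (s : 𝒩.S) : Prop :=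
  ∃ e, ∃ f ∈ 𝒩.F (𝒩.idx s), Reach I 𝒩 d s e f

section Runs

variable {I I' : Interp CN RN IN} {N : Set IN} {h : I.Dom → I'.Dom} {𝒩 : NNFA CN RN IN}

theorem IsRun.accepts (hh : I.IsHom I' N h) (hN : 𝒩.inds ⊆ N) {t : RunTree (I.Dom × 𝒩.S)}
    (ht : IsRun I 𝒩 t) (hl : ∀ x ∈ t.leaves, Accepts I' 𝒩 (h x.1) x.2) :
    Accepts I' 𝒩 (h t.root.1) t.root.2 := by
  induction t with
  | leaf x => exact hl x rfl
  | one x t ih =>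
    obtain ⟨⟨σ, hδ, hσ⟩, ht⟩ := ht
    obtain ⟨e, f, hf, hr⟩ := ih ht hl
    rw [← 𝒩.idx_delta _ _ _ hδ] at hf
    exact ⟨e, f, hf, .sym hδ (hh.sym (by rintro b rfl; exact hN ⟨_, _, hδ⟩) hσ) hr⟩
  | two x t t' ih ih' =>
    obtain ⟨⟨j, hδ, h₁, h₂⟩, ht, ht'⟩ := ht
    obtain ⟨e, f, hf, hr⟩ := ih ht fun x hx => hl x (Or.inl hx)
    obtain ⟨e', f', hf', hr'⟩ := ih' ht' fun x hx => hl x (Or.inr hx)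
    rw [h₁] at hr
    rw [h₂] at hr' hf'
    rw [𝒩.idx_init] at hf'
    rw [← 𝒩.idx_delta _ _ _ hδ] at hf
    exact ⟨e, f, hf, .nest hδ hr' hf' hr⟩

theorem IsRun.idx_root_le {t : RunTree (I.Dom × 𝒩.S)} (ht : IsRun I 𝒩 t) :
    ∀ x ∈ t.leaves, 𝒩.idx t.root.2 ≤ 𝒩.idx x.2 := by
  induction t with
  | leaf x => rintro _ rfl; exact le_rfl
  | one x t ih =>
    obtain ⟨⟨σ, hδ, -⟩, ht⟩ := ht
    exact fun y hy => (𝒩.idx_delta _ _ _ hδ).le.trans (ih ht y hy)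
  | two x t t' ih ih' =>
    obtain ⟨⟨j, hδ, -, h₂⟩, ht, ht'⟩ := ht
    rintro y (hy | hy)
    · exact (𝒩.idx_delta _ _ _ hδ).le.trans (ih ht y hy)
    · have := ih' ht' y hy
      rw [h₂, 𝒩.idx_init] at this
      exact (𝒩.nest_lt _ _ _ hδ).le.trans this

/-- A leaf whose state belongs to the automaton of the root lies on the branch that follows no
nested test, since indices increase along nested tests. That branch is a path of the automaton. -/
theorem IsRun.reach_leaf (hh : I.IsHom I' N h) (hN : 𝒩.inds ⊆ N) {t : RunTree (I.Dom × 𝒩.S)}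
    (ht : IsRun I 𝒩 t)
    (hl : ∀ x ∈ t.leaves, 𝒩.idx t.root.2 < 𝒩.idx x.2 → Accepts I' 𝒩 (h x.1) x.2)
    {x : I.Dom × 𝒩.S} (hx : x ∈ t.leaves) (hi : 𝒩.idx x.2 = 𝒩.idx t.root.2) :
    Reach I' 𝒩 (h t.root.1) t.root.2 (h x.1) x.2 := by
  induction t with
  | leaf y => rw [show x = y from hx]; exact .refl _ _
  | one y t ih =>
    obtain ⟨⟨σ, hδ, hσ⟩, ht⟩ := ht
    have hi' := 𝒩.idx_delta _ _ _ hδ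
    exact .sym hδ (hh.sym (by rintro b rfl; exact hN ⟨_, _, hδ⟩) hσ)
      (ih ht (fun z hz hlt => hl z hz (hi'.trans_lt hlt)) hx (hi.trans hi'))
  | two y t t' ih ih' =>
    obtain ⟨⟨j, hδ, h₁, h₂⟩, ht, ht'⟩ := ht
    have hi' := 𝒩.idx_delta _ _ _ hδ
    have hlt : ∀ z ∈ t'.leaves, 𝒩.idx y.2 < 𝒩.idx z.2 := by
      intro z hz
      have := ht'.idx_root_le z hz
      rw [h₂, 𝒩.idx_init] at this
      exact (𝒩.nest_lt _ _ _ hδ).trans_le this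
    have hacc := ht'.accepts hh hN fun z hz => hl z (Or.inr hz) (hlt z hz)
    rw [h₂] at hacc
    obtain ⟨e, f, hf, hr⟩ := hacc
    rw [𝒩.idx_init] at hf
    rcases hx with hx | hx
    · have := ih ht (fun z hz hlt => hl z (Or.inl hz) (hi'.trans_lt hlt)) hx (hi.trans hi')
      rw [h₁] at this
      exact .nest hδ hr hf this
    · exact absurd hi (hlt x hx).ne'

end Runs

theorem Accepts.of_mem_F {I : Interp CN RN IN} {𝒩 : NNFA CN RN IN} {d : I.Dom} {s : 𝒩.S}
    {j : Fin 𝒩.n} (hs : s ∈ 𝒩.F j) : Accepts I 𝒩 d s :=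
  ⟨d, s, ⟨hs.1, rfl⟩, .refl _ _⟩

section Transitions

variable {𝒩 : NNFA CN RN IN} {C : Finset CN} {Γ : Set 𝒩.S} {o : (canModel T 𝒜).Dom}
  {a₀ : IN} {r : Role RN} {l : List (Role RN × Finset CN)}

theorem JumpTrans.reach {s s' : 𝒩.S} (hJ : JumpTrans T 𝒩 C s s' Γ)
    (ho : o.1 = (a₀, (r, C) :: l)) (hΓ : ∀ u ∈ Γ, Accepts (canModel T 𝒜) 𝒩 o u) :
    Reach (canModel T 𝒜) 𝒩 o s o s' := by
  obtain ⟨⟨a₁, l₁⟩, hv⟩ := o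
  obtain ⟨rfl, rfl⟩ := Prod.mk.inj ho
  obtain ⟨-, hi, -, a, ha, z, t, hz, ht, hroot, hmem, hl⟩ := hJ
  have hzl := canModel_ind.1 hz
  have hom := canModel_singleton_isHom (a := a) hv
  have key := ht.reach_leaf hom (fun b hb hba => ha (Set.mem_singleton_iff.1 hba ▸ hb)) ?_ hmem
    (by rw [hroot]; exact hi.symm)
  · rw [hroot] at key
    simpa only [hzl, List.nil_append] using key
  · intro x hx hlt
    rw [hroot] at hlt
    rcases hl x hx (by rintro rfl; exact hlt.ne hi) with ⟨j, -, hj⟩ | ⟨hxz, hxΓ⟩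
    · exact .of_mem_F hj
    · have := hΓ _ hxΓ
      rw [hxz]
      simpa only [hzl, List.nil_append] using this

theorem FinalTrans.reach {s s' : 𝒩.S} (hF : FinalTrans T 𝒩 C s {s'} Γ)
    (ho : o.1 = (a₀, (r, C) :: l)) (hΓ : ∀ u ∈ Γ, Accepts (canModel T 𝒜) 𝒩 o u) :
    ∃ e, Reach (canModel T 𝒜) 𝒩 o s e s' := by
  obtain ⟨⟨a₁, l₁⟩, hv⟩ := o
  obtain ⟨rfl, rfl⟩ := Prod.mk.inj ho
  obtain ⟨-, hi, -, a, ha, z, t, hz, ht, hroot, ⟨x, hx, rfl⟩, hl⟩ := hF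
  have hzl := canModel_ind.1 hz
  have hom := canModel_singleton_isHom (a := a) hv
  have key := ht.reach_leaf hom (fun b hb hba => ha (Set.mem_singleton_iff.1 hba ▸ hb)) ?_ hx
    (by rw [hroot]; exact hi _ rfl)
  · rw [hroot] at key
    simp only [hzl, List.nil_append] at key
    exact ⟨_, key⟩
  · intro x hx hlt
    rcases hl x hx with ⟨j, hj⟩ | ⟨hxz, hxΓ⟩
    · exact .of_mem_F hj
    · have := hΓ _ hxΓ
      rw [hxz]
      simpa only [hzl, List.nil_append] using this

end Transitions

/-! ### Soundness of the rewriting -/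

section Soundness

variable {I : Interp CN RN IN} {π π' : VN → I.Dom} {y : VN} {L : Set VN}

theorem Interp.term_rename (hy : ∀ v ∈ L, π v = π y) (t : Term IN VN) :
    I.term π (t.rename L y) = I.term π t := by
  cases t with
  | ind b => rfl
  | var v =>
    by_cases hv : v ∈ L
    · simp [Term.rename, hv, Interp.term, hy v hv]
    · simp [Term.rename, hv]

theorem Interp.satAtom_rename (hy : ∀ v ∈ L, π v = π y) (α : Atom CN RN IN VN) :
    I.SatAtom π (α.rename L y) ↔ I.SatAtom π α := by
  cases α <;> simp only [Atom.rename, Interp.SatAtom, Interp.term_rename hy]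

theorem Term.eq_of_mem_rename {v : VN} (hv : v ∈ L) {t : Term IN VN}
    (h : .var v = t.rename L y) : v = y := by
  cases t with
  | ind b => cases h
  | var w =>
    by_cases hw : w ∈ L
    · simpa [Term.rename, hw] using h
    · have : v = w := by simpa [Term.rename, hw] using h
      exact absurd (this ▸ hv) hw

theorem Atom.eq_of_mem_terms_rename {v : VN} (hv : v ∈ L) {α : Atom CN RN IN VN}
    (h : .var v ∈ (α.rename L y).terms) : v = y := by
  cases α with
  | concept A t => exact Term.eq_of_mem_rename hv h
  | role 𝒩 s F t t' => exact h.elim (Term.eq_of_mem_rename hv) (Term.eq_of_mem_rename hv)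
  | test 𝒩 s F t => exact Term.eq_of_mem_rename hv h

theorem Interp.term_congr {t : Term IN VN} (h : ∀ v, t = .var v → π v = π' v) :
    I.term π t = I.term π' t := by
  cases t with
  | ind b => rfl
  | var v => exact congrArg some (h v rfl)

theorem Interp.satAtom_congr {α : Atom CN RN IN VN}
    (h : ∀ v, .var v ∈ α.terms → π v = π' v) : I.SatAtom π α ↔ I.SatAtom π' α := by
  cases α with
  | concept A t =>
    simp only [Interp.SatAtom, Interp.term_congr fun v hv => h v (show _ = _ from hv.symm)]
  | role 𝒩 s F t t' =>
    simp only [Interp.SatAtom, Interp.term_congr fun v hv => h v (Or.inl hv.symm),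
      Interp.term_congr fun v hv => h v (Or.inr hv.symm)]
  | test 𝒩 s F t =>
    simp only [Interp.SatAtom, Interp.term_congr fun v hv => h v (show _ = _ from hv.symm)]

theorem roleChain_terms {𝒩 : NNFA CN RN IN} {t t' x : Term IN VN} {s₀ sn : 𝒩.S} {l : List 𝒩.S}
    {β : Atom CN RN IN VN} (hβ : β ∈ roleChain 𝒩 y t' sn t s₀ l) (hx : x ∈ β.terms) :
    x = .var y ∨ x = t ∨ x = t' := by
  induction l generalizing t s₀ with
  | nil => subst hβ; exact .inr hx
  | cons s₁ l ih =>
    rcases hβ with rfl | hβ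
    · rcases hx with rfl | rfl
      exacts [.inr (.inl rfl), .inl rfl]
    · rcases ih hβ with h | h | h
      exacts [.inl h, .inl h, .inr (.inr h)]

theorem testChain_terms {𝒩 : NNFA CN RN IN} {x : Term IN VN} {s₀ sn : 𝒩.S} {l : List 𝒩.S}
    {β : Atom CN RN IN VN} (hβ : β ∈ testChain 𝒩 y sn s₀ l) (hx : x ∈ β.terms) :
    x = .var y := by
  induction l generalizing s₀ with
  | nil => subst hβ; exact hx
  | cons s₁ l ih =>
    rcases hβ with rfl | hβ
    · rcases hx with rfl | rfl <;> rfl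
    · exact ih hβ

theorem satAtom_of_roleChain {𝒩 : NNFA CN RN IN} {t t' : Term IN VN} {s₀ sn : 𝒩.S}
    {l : List 𝒩.S} (h : ∀ β ∈ roleChain 𝒩 y t' sn t s₀ l, I.SatAtom π β) :
    I.SatAtom π (.role 𝒩 s₀ {sn} t t') := by
  induction l generalizing t s₀ with
  | nil => exact h _ rfl
  | cons s₁ l ih =>
    obtain ⟨d, e, hd, he, _, rfl, hr⟩ := h _ (Or.inl rfl)
    obtain ⟨d', e', hd', he', _, rfl, hr'⟩ := ih fun β hβ => h β (Or.inr hβ)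
    cases he.symm.trans hd'
    exact ⟨d, e', hd, he', _, rfl, hr.trans hr'⟩

theorem satAtom_of_testChain {𝒩 : NNFA CN RN IN} {s₀ sn : 𝒩.S}
    {l : List 𝒩.S} (h : ∀ β ∈ testChain 𝒩 y sn s₀ l, I.SatAtom π β) :
    I.SatAtom π (.test 𝒩 s₀ {sn} (.var y)) := by
  induction l generalizing s₀ with
  | nil => exact h _ rfl
  | cons s₁ l ih =>
    obtain ⟨d, e, hd, he, _, rfl, hr⟩ := h _ (Or.inl rfl)
    obtain ⟨d', e', hd', _, rfl, hr'⟩ := ih fun β hβ => h β (Or.inr hβ)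
    cases he.symm.trans hd'
    exact ⟨d, e', hd, _, rfl, hr.trans hr'⟩

theorem Decompose.satAtom {α : Atom CN RN IN VN} {X : Set (Atom CN RN IN VN)}
    (hD : Decompose y α X) (h : ∀ β ∈ X, I.SatAtom π β) : I.SatAtom π α := by
  cases hD with
  | keep _ _ => exact h _ rfl
  | role 𝒩 s₀ F t t' l sn _ _ _ hn =>
    obtain ⟨d, e, hd, he, _, rfl, hr⟩ := satAtom_of_roleChain h
    exact ⟨d, e, hd, he, _, hn, hr⟩
  | test 𝒩 s₀ F l sn _ _ hn =>
    obtain ⟨d, e, hd, _, rfl, hr⟩ := satAtom_of_testChain h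
    exact ⟨d, e, hd, _, hn, hr⟩

theorem Decompose.terms {α β : Atom CN RN IN VN} {X : Set (Atom CN RN IN VN)}
    (hD : Decompose y α X) (hβ : β ∈ X) {x : Term IN VN} (hx : x ∈ β.terms) :
    x = .var y ∨ x ∈ α.terms := by
  cases hD with
  | keep _ _ => cases hβ; exact .inr hx
  | role 𝒩 s₀ F t t' l sn _ _ _ hn => exact roleChain_terms hβ hx
  | test 𝒩 s₀ F l sn _ _ hn => exact .inl (testChain_terms hβ hx)

theorem Shortcut.terms {C : Finset CN} {α β : Atom CN RN IN VN} {X : Set (Atom CN RN IN VN)}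
    (hS : Shortcut T C y α X) (hβ : β ∈ X) {x : Term IN VN} (hx : x ∈ β.terms) :
    x = .var y ∨ x ∈ α.terms := by
  cases hS with
  | keep => cases hβ; exact .inr hx
  | jump 𝒩 s s' Γ h => obtain ⟨u, hu, rfl⟩ := hβ; exact .inl hx
  | final 𝒩 s s' Γ h => obtain ⟨u, hu, rfl⟩ := hβ; exact .inl hx

theorem Shortcut.satAtom {C : Finset CN} {π : VN → (canModel T 𝒜).Dom} {a₀ : IN} {r : Role RN}
    {l : List (Role RN × Finset CN)} (ho : (π y).1 = (a₀, (r, C) :: l))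
    {α : Atom CN RN IN VN} {X : Set (Atom CN RN IN VN)}
    (hS : Shortcut T C y α X) (h : ∀ β ∈ X, (canModel T 𝒜).SatAtom π β) :
    (canModel T 𝒜).SatAtom π α := by
  have acc : ∀ (𝒩 : NNFA CN RN IN) (Γ : Set 𝒩.S),
      (∀ β ∈ pendingAtoms 𝒩 y Γ, (canModel T 𝒜).SatAtom π β) →
      ∀ u ∈ Γ, Accepts (canModel T 𝒜) 𝒩 (π y) u := by
    intro 𝒩 Γ h u hu
    obtain ⟨d, e, hd, f, hf, hr⟩ := h _ ⟨u, hu, rfl⟩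
    cases hd
    exact ⟨e, f, hf, hr⟩
  cases hS with
  | keep => exact h _ rfl
  | jump 𝒩 s s' Γ hJ => exact ⟨_, _, rfl, rfl, _, rfl, hJ.reach ho (acc 𝒩 Γ h)⟩
  | final 𝒩 s s' Γ hF =>
    obtain ⟨e, he⟩ := hF.reach ho (acc 𝒩 Γ h)
    exact ⟨_, e, rfl, _, rfl, he⟩

/-- The successor `π y` of `π' y` can take over the role of `π' y` before the move. -/
theorem MoveUp.satAtom {r : Role RN} (hT : I.ModelsRI T)
    (hr : (π' y, π y) ∈ I.role r) {α β : Atom CN RN IN VN} (hM : MoveUp T r y α β)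
    (hπ : ∀ v, .var v ∈ α.terms → v ≠ y → π v = π' v) (h : I.SatAtom π' β) :
    I.SatAtom π α := by
  have up : ∀ {𝒩 : NNFA CN RN IN} {u v : 𝒩.S} {e f}, StepUp T r 𝒩 u v →
      Reach I 𝒩 (π' y) v e f → Reach I 𝒩 (π y) u e f := by
    rintro 𝒩 u v e f ⟨r₁, hr₁, hδ⟩ h
    exact .sym hδ ((I.mem_role_inv _ _ _).2 (hT _ _ hr₁ hr)) h
  have down : ∀ {𝒩 : NNFA CN RN IN} {v : 𝒩.S} {U : Set 𝒩.S} {d s}, StepDown T r 𝒩 v U →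
      Reach I 𝒩 d s (π' y) v → ∃ f ∈ U, Reach I 𝒩 d s (π y) f := by
    rintro 𝒩 v U d s ⟨r₂, hr₂, v', hv', hδ⟩ h
    exact ⟨v', hv', h.trans (.sym hδ (hT _ _ hr₂ hr) (.refl _ _))⟩
  cases hM with
  | keep _ hy =>
    exact (Interp.satAtom_congr fun v hv => hπ v hv (by rintro rfl; exact hy hv)).2 h
  | source 𝒩 u v U t ht hi hs =>
    obtain ⟨d, e, hd, he, f, hf, hr⟩ := h
    cases hd
    refine ⟨_, e, rfl, ?_, f, hf, up hs hr⟩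
    rw [← he]
    exact Interp.term_congr fun v hv => hπ v (Or.inr hv.symm) (by rintro rfl; exact ht hv)
  | target 𝒩 u v U t ht hi hs =>
    obtain ⟨d, e, hd, he, _, rfl, hr⟩ := h
    cases he
    refine ⟨d, _, ?_, rfl, down hs hr⟩
    rw [← hd]
    exact Interp.term_congr fun v hv => hπ v (Or.inl hv.symm) (by rintro rfl; exact ht hv)
  | both 𝒩 u v v' U hi hi' hs hs' =>
    obtain ⟨d, e, hd, he, _, rfl, hr⟩ := h
    cases hd
    cases he
    obtain ⟨f, hf, hr⟩ := down hs' hr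
    exact ⟨_, _, rfl, rfl, f, hf, up hs hr⟩
  | test 𝒩 u v U hi hs =>
    obtain ⟨d, e, hd, f, hf, hr⟩ := h
    cases hd
    exact ⟨_, e, rfl, f, hf, up hs hr⟩

end Soundness

theorem canModel_modelsRI : (canModel T 𝒜).ModelsRI T := by
  rintro r r' h ⟨x, y⟩ hxy
  rw [canModel_role, pathRole_iff] at hxy ⊢
  rcases hxy with ⟨h₁, h₂, r₁, hr₁, h'⟩ | ⟨h₁, h₂, r₁, hr₁, h'⟩ | ⟨r₁, C, h₁, h'⟩ |
    ⟨r₁, C, h₁, h'⟩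
  · exact .inl ⟨h₁, h₂, r₁, hr₁, h'.ri_trans h⟩
  · exact .inr (.inl ⟨h₁, h₂, r₁, hr₁, h'.ri_trans h.ri_inv⟩)
  · exact .inr (.inr (.inl ⟨r₁, C, h₁, h'.ri_trans h⟩))
  · exact .inr (.inr (.inr ⟨r₁, C, h₁, h'.ri_trans h.ri_inv⟩))

theorem validPath_cons {D C : Finset CN} {r : Role RN} {a : IN}
    {l : List (Role RN × Finset CN)} (hl : ValidPath T 𝒜 a l)
    (hD : ∀ A ∈ D, CanCon T 𝒜 A (a, l))
    (h : EntailsT IN T (.ci (.conj D) (.ex r (.conj C)))) : ValidPath T 𝒜 a ((r, C) :: l) := by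
  cases l with
  | nil =>
    refine ⟨hl, fun I hI => ?_⟩
    obtain ⟨d, hd⟩ := hI.1.1.2 a
    exact ⟨d, hd, h I hI.1 ((I.mem_conj D d).2 fun A hA => EntailsA.mem_concept (hD A hA) hI hd)⟩
  | cons c l =>
    refine ⟨fun I hI d hd => ?_, hl⟩
    exact h I hI ((I.mem_conj D d).2 fun A hA => hD A hA I hI hd)

/-- A match of the rewritten query sends `y` to an object in `D`. The original query is matched by
sending the variables that were merged into `y` to the `r`-successor of that object with
conjunction `C`. -/
theorem OneStep.exists_isMatch {k : ℕ} {q q' : Query CN RN IN VN k} (h : OneStep T q q')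
    {π' : VN → (canModel T 𝒜).Dom} (hπ' : q'.IsMatch (canModel T 𝒜) π') :
    ∃ π : VN → (canModel T 𝒜).Dom, q.IsMatch (canModel T 𝒜) π ∧
      ∀ i, π (q.ans i) = π' (q'.ans i) := by
  classical
  obtain ⟨L, y, C, D, r, f₄, f₅, f₇, q₂, q₃, q₄, q₅, hyL, hL, rfl, -, hC, rfl, h₄, rfl, h₅, rfl,
    -, hD, h₇, rfl⟩ := h
  have hy : ∀ A ∈ D, π' y ∈ (canModel T 𝒜).con A := by
    intro A hA
    obtain ⟨d, hd, hdA⟩ := hπ' _ (Or.inr ⟨A, hA, rfl⟩)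
    cases hd
    exact hdA
  let o : (canModel T 𝒜).Dom := ⟨((π' y).1.1, (r, C) :: (π' y).1.2), validPath_cons (π' y).2 hy hD⟩
  have hrole : (π' y, o) ∈ (canModel T 𝒜).role r :=
    canModel_role.2 (pathRole_iff.2 (.inr (.inr (.inl ⟨r, C, rfl, .ri_refl T r⟩))))
  let π : VN → (canModel T 𝒜).Dom := fun v => if v ∈ L then o else π' v
  have hπL : ∀ v ∈ L, π v = o := fun v hv => if_pos hv
  have hπn : ∀ v ∉ L, π v = π' v := fun v hv => if_neg hv
  refine ⟨π, ?_, fun i => hπn _ fun hi => (hL hi).2 ⟨i, rfl⟩⟩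
  have hclean₂ : ∀ α ∈ Atom.rename L y '' q.atoms, ∀ v ∈ L, .var v ∈ α.terms → v = y := by
    rintro _ ⟨α, -, rfl⟩ v hv hα
    exact Atom.eq_of_mem_terms_rename hv hα
  intro α₀ hα₀
  rw [← Interp.satAtom_rename (L := L) (y := y) fun v hv => (hπL v hv).trans (hπL y hyL).symm]
  have hα : Atom.rename L y α₀ ∈ Atom.rename L y '' q.atoms := ⟨α₀, hα₀, rfl⟩
  generalize Atom.rename L y α₀ = α at hα
  by_cases hB : ∃ B, α = .concept B (.var y)
  · obtain ⟨B, rfl⟩ := hB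
    exact ⟨o, congrArg some (hπL y hyL), hC B hα⟩
  have hα₃ : α ∈ (Atom.rename L y '' q.atoms) \ {α | ∃ B, α = .concept B (.var y)} := ⟨hα, hB⟩
  refine (h₄ α hα₃).satAtom fun β hβ => ?_
  have hβ₄ := Set.mem_biUnion (t := f₄) hα₃ hβ
  have hyo : (π y).1 = ((π' y).1.1, (r, C) :: (π' y).1.2) := by rw [hπL y hyL]
  refine (h₅ β hβ₄).satAtom hyo fun γ hγ => ?_
  have hγ₅ := Set.mem_biUnion (t := f₅) hβ₄ hγ
  refine (h₇ γ hγ₅).satAtom canModel_modelsRI ((hπL y hyL).symm ▸ hrole) (fun v hv hvy => ?_)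
    (hπ' _ (Or.inl ⟨γ, hγ₅, rfl⟩))
  refine hπn v fun hvL => hvy ?_
  rcases (h₅ β hβ₄).terms hγ hv with hv | hv
  · cases hv; rfl
  rcases (h₄ α hα₃).terms hβ hv with hv | hv
  · cases hv; rfl
  exact hclean₂ α hα v hvL hv

theorem HasCoreMatch.certainAnswer {k : ℕ} {q : Query CN RN IN VN k} {a : Fin k → IN}
    (h : HasCoreMatch q T 𝒜 a) : q.CertainAnswer T 𝒜 a := by
  obtain ⟨q', hq', π, hπ, hans, -⟩ := h
  suffices ∃ π : VN → (canModel T 𝒜).Dom, q.IsMatch (canModel T 𝒜) π ∧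
      ∀ i, (canModel T 𝒜).ind (a i) = some (π (q.ans i)) by
    obtain ⟨π, hπ, hans⟩ := this
    exact certainAnswer_of_canModel hπ hans
  induction hq' using Relation.ReflTransGen.head_induction_on with
  | refl => exact ⟨π, hπ, hans⟩
  | head h _ ih =>
    obtain ⟨π₁, hπ₁, hans₁⟩ := ih
    obtain ⟨π₂, hπ₂, hans₂⟩ := h.exists_isMatch hπ₁
    exact ⟨π₂, hπ₂, fun i => (hans₁ i).trans (congrArg some (hans₂ i).symm)⟩

/-! ### The part of the generated model below an object -/

/-- The object `x` is `o` or lies below `o`. -/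
def IsBelow (o x : (genModel T 𝒜).Dom) : Prop :=
  ∃ m, x.1 = (o.1.1, m ++ o.1.2)

/-- The object `x = o r₁ C₁ … rₙ Cₙ` corresponds to `z = a r₁ C₁ … rₙ Cₙ` in the canonical model
of `{C(a)}`. -/
def Corresponds {𝒜' : ABox CN RN IN} (a : IN) (o x : (genModel T 𝒜).Dom)
    (z : (canModel T 𝒜').Dom) : Prop :=
  ∃ m, x.1 = (o.1.1, m ++ o.1.2) ∧ z.1 = (a, m)

section Below

variable {o o' x x' : (genModel T 𝒜).Dom} {r : Role RN} {C : Finset CN}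

theorem IsBelow.refl (o : (genModel T 𝒜).Dom) : IsBelow o o := ⟨[], rfl⟩

theorem IsBelow.eq_of_length_le (h : IsBelow o x) (hl : x.1.2.length ≤ o.1.2.length) :
    x = o := by
  obtain ⟨m, hm⟩ := h
  rw [hm] at hl
  obtain rfl : m = [] := by
    apply List.length_eq_zero_iff.1
    simp only [List.length_append] at hl
    omega
  exact Subtype.ext hm

theorem not_isBelow_parent (hoo' : o.1 = (o'.1.1, (r, C) :: o'.1.2)) : ¬ IsBelow o o' := by
  rintro ⟨m, hm⟩
  have := congrArg (fun p => p.2.length) hm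
  rw [hoo'] at this
  simp at this
  omega

/-- A role leads out of the part below `o` only from `o` to its predecessor. -/
theorem IsBelow.exit (hoo' : o.1 = (o'.1.1, (r, C) :: o'.1.2)) {ρ : Role RN} (hx : IsBelow o x)
    (hx' : ¬ IsBelow o x') (h : (x, x') ∈ (genModel T 𝒜).role ρ) :
    x = o ∧ x' = o' ∧ EntailsT IN T (.ri r ρ.inv) := by
  obtain ⟨m, hm⟩ := hx
  have hne : x.1.2 ≠ [] := by rw [hm, hoo']; simp
  rcases pathRole_iff.1 (genModel_role.1 h) with ⟨h₁, -⟩ | ⟨h₁, -⟩ | ⟨r', C', h', -⟩ |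
    ⟨r', C', h', hT⟩
  · exact (hne h₁).elim
  · exact (hne h₁).elim
  · exact (hx' ⟨(r', C') :: m, by rw [h', hm]; rfl⟩).elim
  · cases m with
    | nil =>
      have hxo : x = o := Subtype.ext hm
      rw [hxo, hoo', Prod.mk.injEq, List.cons.injEq, Prod.mk.injEq] at h'
      obtain ⟨h₁, ⟨rfl, -⟩, h₂⟩ := h'
      exact ⟨hxo, Subtype.ext (Prod.ext h₁.symm h₂.symm), hT⟩
    | cons c m =>
      rw [hm, Prod.mk.injEq, List.cons_append, List.cons.injEq] at h'
      exact (hx' ⟨m, Prod.ext h'.1.symm h'.2.2.symm⟩).elim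

theorem IsBelow.enter (hoo' : o.1 = (o'.1.1, (r, C) :: o'.1.2)) {ρ : Role RN}
    (hx : ¬ IsBelow o x) (hx' : IsBelow o x') (h : (x, x') ∈ (genModel T 𝒜).role ρ) :
    x = o' ∧ x' = o ∧ EntailsT IN T (.ri r ρ) := by
  have := hx'.exit hoo' hx ((Interp.mem_role_inv _ _ _ _).2 h)
  rw [Role.inv_inv] at this
  exact ⟨this.2.1, this.1, this.2.2⟩

theorem IsBelow.not_ind (hoo' : o.1 = (o'.1.1, (r, C) :: o'.1.2)) (hx : IsBelow o x) (b : IN) :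
    (genModel T 𝒜).ind b ≠ some x := by
  intro h
  obtain ⟨m, hm⟩ := hx
  rw [genModel_ind.1 h, hoo'] at hm
  simpa using congrArg Prod.snd hm

end Below

section Correspondence

variable {o o' x x' : (genModel T 𝒜).Dom} {r : Role RN} {C : Finset CN} {a : IN}
  {z z' : (canModel T {.concept (.conj C) a}).Dom}

theorem Corresponds.isBelow (h : Corresponds a o x z) : IsBelow o x := ⟨h.choose, h.choose_spec.1⟩

/-- Below `o`, being a path depends only on the last conjunction `C` of `o`. -/
theorem IsBelow.exists_corresponds (hoo' : o.1 = (o'.1.1, (r, C) :: o'.1.2)) (h : IsBelow o x)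
    (a : IN) : ∃ z : (canModel T {.concept (.conj C) a}).Dom, Corresponds a o x z := by
  obtain ⟨m, hm⟩ := h
  have key : ∀ m, GenPath T 𝒜 o'.1.1 (m ++ (r, C) :: o'.1.2) →
      ValidPath T {.concept (.conj C) a} a m := by
    intro m hv
    induction m with
    | nil => exact inds_singleton_concept.2 rfl
    | cons c m ih =>
      obtain ⟨r', C'⟩ := c
      cases m with
      | nil => exact ⟨ih hv.2, entailsA_singleton_iff.2 hv.1.1.2⟩
      | cons c' m => exact ⟨hv.1.1.2, ih hv.2⟩
  have hv := x.2
  rw [hm, hoo'] at hv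
  exact ⟨⟨(a, m), key m hv⟩, m, hm, rfl⟩

theorem Corresponds.role (h : Corresponds a o x z) (h' : Corresponds a o x' z')
    (hoo' : o.1 = (o'.1.1, (r, C) :: o'.1.2)) {ρ : Role RN}
    (hρ : (x, x') ∈ (genModel T 𝒜).role ρ) :
    (z, z') ∈ (canModel T {.concept (.conj C) a}).role ρ := by
  obtain ⟨m, hm, hz⟩ := h
  obtain ⟨m', hm', hz'⟩ := h'
  have hne : x.1.2 ≠ [] := by rw [hm, hoo']; simp
  refine canModel_role.2 (pathRole_iff.2 ?_)
  rcases pathRole_iff.1 (genModel_role.1 hρ) with ⟨h₁, -⟩ | ⟨h₁, -⟩ | ⟨r', C', h', hT⟩ |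
    ⟨r', C', h', hT⟩
  · exact (hne h₁).elim
  · exact (hne h₁).elim
  · rw [hm, hm', Prod.mk.injEq] at h'
    refine .inr (.inr (.inl ⟨r', C', ?_, hT⟩))
    rw [hz, hz', List.append_cancel_right (as := m') (cs := (r', C') :: m) h'.2]
  · rw [hm, hm', Prod.mk.injEq] at h'
    refine .inr (.inr (.inr ⟨r', C', ?_, hT⟩))
    rw [hz, hz', List.append_cancel_right (as := m) (cs := (r', C') :: m') h'.2]

theorem Corresponds.con (h : Corresponds a o x z)
    (hoo' : o.1 = (o'.1.1, (r, C) :: o'.1.2)) {A : CN} (hA : x ∈ (genModel T 𝒜).con A) :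
    z ∈ (canModel T {.concept (.conj C) a}).con A := by
  obtain ⟨m, hm, hz⟩ := h
  change CanCon T 𝒜 A x.1 at hA
  change CanCon T _ A z.1
  rw [hm, hoo'] at hA
  rw [hz]
  cases m with
  | nil => exact entailsA_singleton_iff.2 hA
  | cons c m => exact hA

theorem Corresponds.unique (h : Corresponds a o x z) (h' : Corresponds a o x z') : z = z' := by
  obtain ⟨m, hm, hz⟩ := h
  obtain ⟨m', hm', hz'⟩ := h'
  rw [hm, Prod.mk.injEq] at hm'
  obtain rfl := List.append_cancel_right hm'.2
  exact Subtype.ext (hz.trans hz'.symm)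

theorem Corresponds.ind (h : Corresponds a o o z) :
    (canModel T {.concept (.conj C) a}).ind a = some z := by
  obtain ⟨m, hm, hz⟩ := h
  have h₁ : o.1.2 = m ++ o.1.2 := congrArg Prod.snd hm
  obtain rfl : m = [] := by simpa using h₁
  exact canModel_ind.2 hz

end Correspondence

/-! ### Partial runs from paths of the generated model -/

section Runs

variable {o o' x e : (genModel T 𝒜).Dom} {r : Role RN} {C : Finset CN} {a : IN}
  {𝒩 : NNFA CN RN IN}

/-- The states with index above `i` from which the automaton can accept at `o` after a first step
from `o` to its predecessor `o'`. A nested run that leaves the part below `o` does so in such a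
state. -/
def pendingStates (T : TBox CN RN) (r : Role RN) (𝒩 : NNFA CN RN IN) (o' : (genModel T 𝒜).Dom)
    (i : Fin 𝒩.n) : Set 𝒩.S :=
  {u | i < 𝒩.idx u ∧ ∃ v, StepUp T r 𝒩 u v ∧
    ∃ e, ∃ f ∈ 𝒩.F (𝒩.idx u), Reach (genModel T 𝒜) 𝒩 o' v e f}

/-- The condition on the side leaves of the partial runs in a jump transition, with all pending
states allowed. -/
def IsClosed (T : TBox CN RN) (r : Role RN) (C : Finset CN) (a : IN) (𝒩 : NNFA CN RN IN)
    (o' : (genModel T 𝒜).Dom) (i : Fin 𝒩.n)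
    (x : (canModel T {.concept (.conj C) a}).Dom × 𝒩.S) : Prop :=
  (∃ j, i < j ∧ x.2 ∈ 𝒩.F j) ∨
    ((canModel T {.concept (.conj C) a}).ind a = some x.1 ∧ x.2 ∈ pendingStates T r 𝒩 o' i)

/-- One step of a path starting below `o`: it stays below `o`, with a matching step in the
canonical model of `{C(a)}`, or leaves from `o` to its predecessor. -/
theorem step_cases (hoo' : o.1 = (o'.1.1, (r, C) :: o'.1.2)) {x' : (genModel T 𝒜).Dom}
    {z : (canModel T {.concept (.conj C) a}).Dom} (hz : Corresponds a o x z)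
    {σ : Sym CN RN IN} (hσ : (x, x') ∈ (genModel T 𝒜).sym σ) :
    (∃ z', Corresponds a o x' z' ∧ (z, z') ∈ (canModel T {.concept (.conj C) a}).sym σ) ∨
      (x = o ∧ x' = o' ∧ ∃ r₁ : Role RN, σ = .role r₁.inv ∧ EntailsT IN T (.ri r r₁)) := by
  cases σ with
  | role ρ =>
    by_cases hx' : IsBelow o x'
    · obtain ⟨z', hz'⟩ := hx'.exists_corresponds hoo' a
      exact .inl ⟨z', hz', hz.role hz' hoo' hσ⟩
    · obtain ⟨h₁, h₂, h₃⟩ := hz.isBelow.exit hoo' hx' hσ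
      exact .inr ⟨h₁, h₂, ρ.inv, by rw [Role.inv_inv], h₃⟩
  | testInd b => exact (hz.isBelow.not_ind hoo' b hσ.2).elim
  | testCon A =>
    obtain ⟨h, hA⟩ := hσ
    obtain rfl : x = x' := h
    exact .inl ⟨z, hz, rfl, hz.con hoo' hA⟩

/-- An accepting nested path that starts below `o` yields a partial run that is cut off wherever the
path, or a path nested in it, leaves the part below `o`. -/
theorem exists_nested_run (hoo' : o.1 = (o'.1.1, (r, C) :: o'.1.2)) {s f : 𝒩.S}
    (hr : Reach (genModel T 𝒜) 𝒩 x s e f) {i : Fin 𝒩.n} (hf : f ∈ 𝒩.F (𝒩.idx s))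
    (hi : i < 𝒩.idx s) {z : (canModel T {.concept (.conj C) a}).Dom}
    (hz : Corresponds a o x z) :
    ∃ t, IsRun (canModel T {.concept (.conj C) a}) 𝒩 t ∧ t.root = (z, s) ∧
      ∀ y ∈ t.leaves, IsClosed T r C a 𝒩 o' i y := by
  induction hr generalizing z with
  | refl x s => exact ⟨.leaf (z, s), trivial, rfl, by rintro _ rfl; exact .inl ⟨_, hi, hf⟩⟩
  | @sym x x' e s s' f σ hδ hσ hr ih =>
    have hidx := 𝒩.idx_delta _ _ _ hδ
    rcases step_cases hoo' hz hσ with ⟨z', hz', hzz'⟩ | ⟨rfl, rfl, r₁, rfl, hr₁⟩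
    · obtain ⟨t, ht, hroot, hl⟩ := ih (hidx ▸ hf) (hidx ▸ hi) hz'
      exact ⟨.one (z, s) t, ⟨⟨σ, by rw [hroot]; exact hδ, by rw [hroot]; exact hzz'⟩, ht⟩, rfl, hl⟩
    · refine ⟨.leaf (z, s), trivial, rfl, ?_⟩
      rintro _ rfl
      exact .inr ⟨hz.ind, hi, s', ⟨r₁, hr₁, hδ⟩, e, f, hf, hr⟩
  | @nest x x₁ e s s' f f' j hδ hj hf' hr ih₁ ih₂ =>
    have hidx := 𝒩.idx_delta _ _ _ hδ
    have hij := hi.trans (𝒩.nest_lt _ _ _ hδ)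
    obtain ⟨t, ht, hroot, hl⟩ := ih₂ (hidx ▸ hf) (hidx ▸ hi) hz
    obtain ⟨t', ht', hroot', hl'⟩ := ih₁ (by rwa [𝒩.idx_init]) (by rwa [𝒩.idx_init]) hz
    refine ⟨.two (z, s) t t', ⟨⟨j, by rw [hroot]; exact hδ, by rw [hroot], hroot'⟩, ht, ht'⟩, rfl,
      ?_⟩
    rintro y (hy | hy)
    exacts [hl y hy, hl' y hy]

/-- Some partial run on the canonical model of `{C(a)}` follows a path from `(x, s)` to `(e, f)`
that stays below `o`; its nested runs stop where they leave the part below `o`. -/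
def DownPath (T : TBox CN RN) (r : Role RN) (C : Finset CN) (a : IN) (𝒩 : NNFA CN RN IN)
    (o o' x : (genModel T 𝒜).Dom) (s : 𝒩.S) (e : (genModel T 𝒜).Dom) (f : 𝒩.S) : Prop :=
  ∃ (z ze : (canModel T {.concept (.conj C) a}).Dom) (t : RunTree _),
    Corresponds a o x z ∧ Corresponds a o e ze ∧
    IsRun (canModel T {.concept (.conj C) a}) 𝒩 t ∧ t.root = (z, s) ∧ (ze, f) ∈ t.leaves ∧
    ∀ y ∈ t.leaves, y ≠ (ze, f) → IsClosed T r C a 𝒩 o' (𝒩.idx s) y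

theorem DownPath.refl (hoo' : o.1 = (o'.1.1, (r, C) :: o'.1.2)) (hx : IsBelow o x) (s : 𝒩.S) :
    DownPath T r C a 𝒩 o o' x s x s := by
  obtain ⟨z, hz⟩ := hx.exists_corresponds hoo' a
  exact ⟨z, z, .leaf (z, s), hz, hz, trivial, rfl, rfl, fun y hy hne => (hne hy).elim⟩

theorem DownPath.sym {x' : (genModel T 𝒜).Dom} {s s' f : 𝒩.S} {σ : Sym CN RN IN}
    {z z' : (canModel T {.concept (.conj C) a}).Dom} (hδ : (s, Label.sym σ, s') ∈ 𝒩.delta)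
    (hz : Corresponds a o x z) (hz' : Corresponds a o x' z')
    (hσ : (z, z') ∈ (canModel T {.concept (.conj C) a}).sym σ)
    (h : DownPath T r C a 𝒩 o o' x' s' e f) : DownPath T r C a 𝒩 o o' x s e f := by
  obtain ⟨z₁, ze, t, hz₁, hze, ht, hroot, hmem, hl⟩ := h
  obtain rfl := hz'.unique hz₁
  refine ⟨z, ze, .one (z, s) t, hz, hze,
    ⟨⟨σ, by rw [hroot]; exact hδ, by rw [hroot]; exact hσ⟩, ht⟩, rfl, hmem, fun y hy hne => ?_⟩
  rw [𝒩.idx_delta _ _ _ hδ]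
  exact hl y hy hne

theorem DownPath.nest (hoo' : o.1 = (o'.1.1, (r, C) :: o'.1.2)) {x₁ : (genModel T 𝒜).Dom}
    {s s' f f' : 𝒩.S} {j : Fin 𝒩.n} (hδ : (s, Label.nest j, s') ∈ 𝒩.delta)
    (hj : Reach (genModel T 𝒜) 𝒩 x (𝒩.init j) x₁ f') (hf' : f' ∈ 𝒩.F j)
    (h : DownPath T r C a 𝒩 o o' x s' e f) : DownPath T r C a 𝒩 o o' x s e f := by
  obtain ⟨z, ze, t, hz, hze, ht, hroot, hmem, hl⟩ := h
  obtain ⟨t', ht', hroot', hl'⟩ := exists_nested_run hoo' hj (i := 𝒩.idx s)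
    (by rwa [𝒩.idx_init]) (by rw [𝒩.idx_init]; exact 𝒩.nest_lt _ _ _ hδ) hz
  refine ⟨z, ze, .two (z, s) t t', hz, hze,
    ⟨⟨j, by rw [hroot]; exact hδ, by rw [hroot], hroot'⟩, ht, ht'⟩, rfl, Or.inl hmem, ?_⟩
  rintro y (hy | hy) hne
  · rw [𝒩.idx_delta _ _ _ hδ]
    exact hl y hy hne
  · exact hl' y hy

/-- A path that starts below `o` stays there, or it leaves at some point from `o` to its
predecessor. -/
theorem Reach.first_exit (hoo' : o.1 = (o'.1.1, (r, C) :: o'.1.2)) (a : IN) {s f : 𝒩.S}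
    (hr : Reach (genModel T 𝒜) 𝒩 x s e f) (hx : IsBelow o x) :
    DownPath T r C a 𝒩 o o' x s e f ∨
      ∃ s₁ v, DownPath T r C a 𝒩 o o' x s o s₁ ∧ StepUp T r 𝒩 s₁ v ∧
        Reach (genModel T 𝒜) 𝒩 o' v e f := by
  induction hr with
  | refl x s => exact .inl (.refl hoo' hx s)
  | @sym x x' e s s' f σ hδ hσ hr ih =>
    obtain ⟨z, hz⟩ := hx.exists_corresponds hoo' a
    rcases step_cases hoo' hz hσ with ⟨z', hz', hzz'⟩ | ⟨rfl, rfl, r₁, rfl, hr₁⟩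
    · rcases ih hz'.isBelow with h | ⟨s₁, v, h, hv⟩
      · exact .inl (h.sym hδ hz hz' hzz')
      · exact .inr ⟨s₁, v, h.sym hδ hz hz' hzz', hv⟩
    · exact .inr ⟨s, s', .refl hoo' hx s, ⟨r₁, hr₁, hδ⟩, hr⟩
  | nest hδ hj hf hr _ ih =>
    rcases ih hx with h | ⟨s₁, v, h, hv⟩
    · exact .inl (h.nest hoo' hδ hj hf)
    · exact .inr ⟨s₁, v, h.nest hoo' hδ hj hf, hv⟩

/-- A path that ends below `o` is there all the time, or it enters for the last time at some
point, from the predecessor of `o` to `o`. -/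
theorem Reach.last_entry (hoo' : o.1 = (o'.1.1, (r, C) :: o'.1.2)) (a : IN) {s f : 𝒩.S}
    (hr : Reach (genModel T 𝒜) 𝒩 x s e f) (he : IsBelow o e) :
    (IsBelow o x ∧ DownPath T r C a 𝒩 o o' x s e f) ∨
      ∃ v s₂, Reach (genModel T 𝒜) 𝒩 x s o' v ∧ StepDown T r 𝒩 v {s₂} ∧
        DownPath T r C a 𝒩 o o' o s₂ e f := by
  induction hr with
  | refl x s => exact .inl ⟨he, .refl hoo' he s⟩
  | @sym x x' e s s' f σ hδ hσ hr ih =>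
    rcases ih he with ⟨hx', h⟩ | ⟨v, s₂, h, hv⟩
    · by_cases hx : IsBelow o x
      · obtain ⟨z, hz⟩ := hx.exists_corresponds hoo' a
        rcases step_cases hoo' hz hσ with ⟨z', hz', hzz'⟩ | ⟨rfl, rfl, -⟩
        · exact .inl ⟨hx, h.sym hδ hz hz' hzz'⟩
        · exact (not_isBelow_parent hoo' hx').elim
      · cases σ with
        | role ρ =>
          obtain ⟨rfl, rfl, hρ⟩ := IsBelow.enter hoo' hx hx' hσ
          exact .inr ⟨s, s', .refl _ _, ⟨ρ, hρ, s', rfl, hδ⟩, h⟩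
        | testInd b => exact (hx ((show x = x' from hσ.1) ▸ hx')).elim
        | testCon A => exact (hx ((show x = x' from hσ.1) ▸ hx')).elim
    · exact .inr ⟨v, s₂, .sym hδ hσ h, hv⟩
  | nest hδ hj hf hr _ ih =>
    rcases ih he with ⟨hx, h⟩ | ⟨v, s₂, h, hv⟩
    · exact .inl ⟨hx, h.nest hoo' hδ hj hf⟩
    · exact .inr ⟨v, s₂, .nest hδ hj hf h, hv⟩


end Runs

/-! ### Jump and final transitions from paths -/

section Transitions

variable {o o' e : (genModel T 𝒜).Dom} {r : Role RN} {C : Finset CN} {a : IN}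
  {𝒩 : NNFA CN RN IN} {s s' f : 𝒩.S}

theorem DownPath.jumpTrans (h : DownPath T r C a 𝒩 o o' o s o s') (ha : a ∉ 𝒩.inds)
    (hC : ↑C ⊆ T.names) (hi : 𝒩.idx s = 𝒩.idx s') :
    JumpTrans T 𝒩 C s s' (pendingStates T r 𝒩 o' (𝒩.idx s)) := by
  obtain ⟨z, ze, t, hz, hze, ht, hroot, hmem, hl⟩ := h
  obtain rfl := hz.unique hze
  refine ⟨hC, hi, fun u hu => hu.1, a, ha, z, t, hz.ind, ht, hroot, hmem, fun y hy hne => ?_⟩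
  exact (hl y hy hne).imp id fun h => ⟨Option.some.inj (h.1.symm.trans hz.ind), h.2⟩

theorem DownPath.finalTrans (h : DownPath T r C a 𝒩 o o' o s e f) (ha : a ∉ 𝒩.inds)
    (hC : ↑C ⊆ T.names) (hi : 𝒩.idx s = 𝒩.idx f) (hf : f ∈ 𝒩.final) :
    FinalTrans T 𝒩 C s {f} (pendingStates T r 𝒩 o' (𝒩.idx s)) := by
  obtain ⟨z, ze, t, hz, hze, ht, hroot, hmem, hl⟩ := h
  refine ⟨hC, by rintro _ rfl; exact hi.symm, fun u hu => hu.1, a, ha, z, t, hz.ind, ht, hroot,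
    ⟨_, hmem, rfl⟩, fun y hy => ?_⟩
  by_cases hne : y = (ze, f)
  · exact .inl ⟨𝒩.idx f, by rw [hne]; exact ⟨hf, rfl⟩⟩
  · exact (hl y hy hne).imp (fun ⟨j, _, hj⟩ => ⟨j, hj⟩)
      fun h => ⟨Option.some.inj (h.1.symm.trans hz.ind), h.2⟩

end Transitions

theorem StepUp.idx_eq {r : Role RN} {𝒩 : NNFA CN RN IN} {u v : 𝒩.S} (h : StepUp T r 𝒩 u v) :
    𝒩.idx v = 𝒩.idx u := by
  obtain ⟨_, _, hδ⟩ := h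
  exact (𝒩.idx_delta _ _ _ hδ).symm

theorem StepDown.idx_eq {r : Role RN} {𝒩 : NNFA CN RN IN} {v s : 𝒩.S}
    (h : StepDown T r 𝒩 v {s}) : 𝒩.idx v = 𝒩.idx s := by
  obtain ⟨_, _, _, rfl, hδ⟩ := h
  exact 𝒩.idx_delta _ _ _ hδ

/-! ### Invariants of the rewriting -/

theorem MoveUp.terms {r : Role RN} {y : VN} {α β : Atom CN RN IN VN} (h : MoveUp T r y α β) :
    β.terms = α.terms := by cases h <;> rfl

theorem Term.eq_or_eq_of_rename {L : Set VN} {y v : VN} {t : Term IN VN}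
    (h : .var v = t.rename L y) : v = y ∨ t = .var v := by
  cases t with
  | ind b => cases h
  | var w =>
    by_cases hw : w ∈ L
    · exact .inl (by simpa [Term.rename, hw] using h)
    · refine .inr ?_
      simpa [Term.rename, hw] using h.symm

theorem Atom.eq_or_mem_terms_of_rename {L : Set VN} {y v : VN} {α : Atom CN RN IN VN}
    (h : .var v ∈ (α.rename L y).terms) : v = y ∨ .var v ∈ α.terms := by
  cases α with
  | concept A t => exact (Term.eq_or_eq_of_rename h).imp id fun h => h.symm
  | role 𝒩 s F t t' =>
    rcases h with h | h
    · exact (Term.eq_or_eq_of_rename h).imp id fun h => .inl h.symm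
    · exact (Term.eq_or_eq_of_rename h).imp id fun h => .inr h.symm
  | test 𝒩 s F t => exact (Term.eq_or_eq_of_rename h).imp id fun h => h.symm

theorem OneStep.vars_subset {k : ℕ} {q q' : Query CN RN IN VN k} (h : OneStep T q q') :
    q'.vars ⊆ q.vars := by
  obtain ⟨L, y, C, D, r, f₄, f₅, f₇, q₂, q₃, q₄, q₅, hyL, hL, rfl, -, hC, rfl, h₄, rfl, h₅, rfl,
    -, hD, h₇, rfl⟩ := h
  have hy : y ∈ q.vars := (hL hyL).1
  rintro v ⟨_, ⟨γ, hγ, rfl⟩ | ⟨A, hA, rfl⟩, hv⟩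
  · rw [(h₇ γ hγ).terms] at hv
    obtain ⟨β, hβ, hγβ⟩ := Set.mem_iUnion₂.1 hγ
    rcases (h₅ β hβ).terms hγβ hv with hv | hv
    · cases hv; exact hy
    obtain ⟨α, hα, hβα⟩ := Set.mem_iUnion₂.1 hβ
    rcases (h₄ α hα).terms hβα hv with hv | hv
    · cases hv; exact hy
    obtain ⟨⟨α₀, hα₀, rfl⟩, -⟩ := hα
    rcases Atom.eq_or_mem_terms_of_rename hv with rfl | hv
    · exact hy
    · exact ⟨α₀, hα₀, hv⟩
  · cases hv; exact hy

/-- In a test atom `⟨𝒩_{s,F}⟩(t)`, all states of `F` are final. -/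
def Atom.FinalTest : Atom CN RN IN VN → Prop
  | .test 𝒩 _ F _ => F ⊆ 𝒩.final
  | _ => True

theorem finalTest_of_roleChain {𝒩 : NNFA CN RN IN} {y : VN} {t t' : Term IN VN} {s₀ sn : 𝒩.S}
    {l : List 𝒩.S} {β : Atom CN RN IN VN} (hβ : β ∈ roleChain 𝒩 y t' sn t s₀ l) :
    β.FinalTest := by
  induction l generalizing t s₀ with
  | nil => subst hβ; trivial
  | cons s₁ l ih =>
    rcases hβ with rfl | hβ
    · trivial
    · exact ih hβ

theorem finalTest_of_testChain {𝒩 : NNFA CN RN IN} {y : VN} {s₀ sn : 𝒩.S} {l : List 𝒩.S}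
    (hn : sn ∈ 𝒩.final) {β : Atom CN RN IN VN} (hβ : β ∈ testChain 𝒩 y sn s₀ l) :
    β.FinalTest := by
  induction l generalizing s₀ with
  | nil => subst hβ; exact Set.singleton_subset_iff.2 hn
  | cons s₁ l ih =>
    rcases hβ with rfl | hβ
    · trivial
    · exact ih hβ

/-- Test atoms are only introduced for the final states of an automaton. Final transitions
`(C, s, {s'}, Γ)` require `s'` to be final, so this is what makes them applicable. -/
theorem OneStep.finalTest {k : ℕ} {q q' : Query CN RN IN VN k} (h : OneStep T q q')
    (hq : ∀ α ∈ q.atoms, α.FinalTest) : ∀ α ∈ q'.atoms, α.FinalTest := by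
  obtain ⟨L, y, C, D, r, f₄, f₅, f₇, q₂, q₃, q₄, q₅, hyL, hL, rfl, -, hC, rfl, h₄, rfl, h₅, rfl,
    -, hD, h₇, rfl⟩ := h
  rintro _ (⟨γ, hγ, rfl⟩ | ⟨A, hA, rfl⟩)
  · obtain ⟨β, hβ, hγβ⟩ := Set.mem_iUnion₂.1 hγ
    obtain ⟨α, hα, hβα⟩ := Set.mem_iUnion₂.1 hβ
    have h₁ : α.FinalTest := by
      obtain ⟨⟨α₀, hα₀, rfl⟩, -⟩ := hα
      have := hq α₀ hα₀
      cases α₀ <;> exact this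
    have h₂ : β.FinalTest := by
      have := h₄ α hα
      generalize f₄ α = X at this hβα
      cases this with
      | keep => cases hβα; exact h₁
      | role => exact finalTest_of_roleChain hβα
      | test 𝒩 s₀ F l sn hd hl hn => exact finalTest_of_testChain (h₁ hn) hβα
    have h₃ : γ.FinalTest := by
      have := h₅ β hβ
      generalize f₅ β = X at this hγβ
      cases this with
      | keep => cases hγβ; exact h₂
      | jump => obtain ⟨u, -, rfl⟩ := hγβ; exact fun f hf => hf.1
      | final => obtain ⟨u, -, rfl⟩ := hγβ; exact fun f hf => hf.1
    have := h₇ γ hγ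
    generalize f₇ γ = δ at this
    cases this <;> exact h₃
  · trivial

/-! ### Completeness of the rewriting -/

/-- The atom `β` can be shortcut and moved to the predecessor so that the resulting atoms hold
under `π'`. -/
def Lifts (T : TBox CN RN) (r : Role RN) (C : Finset CN) (y : VN) (I : Interp CN RN IN)
    (π' : VN → I.Dom) (β : Atom CN RN IN VN) : Prop :=
  ∃ Y, Shortcut T C y β Y ∧ ∀ γ ∈ Y, ∃ δ, MoveUp T r y γ δ ∧ I.SatAtom π' δ

section Lifts

variable {I : Interp CN RN IN} {r : Role RN} {C : Finset CN} {y : VN} {π' : VN → I.Dom}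
  {𝒩 : NNFA CN RN IN} {s s' f v v' : 𝒩.S} {t : Term IN VN} {d e : I.Dom}

theorem Lifts.of_moveUp {β δ : Atom CN RN IN VN} (h : MoveUp T r y β δ)
    (hδ : I.SatAtom π' δ) : Lifts T r C y I π' β :=
  ⟨_, .keep β, by rintro _ rfl; exact ⟨δ, h, hδ⟩⟩

theorem Lifts.up_down (hv : StepUp T r 𝒩 s v) (hr : Reach I 𝒩 (π' y) v (π' y) v')
    (hv' : StepDown T r 𝒩 v' {s'}) : Lifts T r C y I π' (.role 𝒩 s {s'} (.var y) (.var y)) :=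
  .of_moveUp (.both 𝒩 s v v' _ hv.idx_eq (hr.idx_eq.symm.trans hv.idx_eq) hv hv')
    ⟨_, _, rfl, rfl, _, rfl, hr⟩

theorem Lifts.source (hv : StepUp T r 𝒩 s v) (hr : Reach I 𝒩 (π' y) v e f)
    (ht : t ≠ .var y) (he : I.term π' t = some e) :
    Lifts T r C y I π' (.role 𝒩 s {f} (.var y) t) :=
  .of_moveUp (.source 𝒩 s v _ t ht hv.idx_eq hv) ⟨_, _, rfl, he, _, rfl, hr⟩

theorem Lifts.target (hr : Reach I 𝒩 d s (π' y) v) (hv : StepDown T r 𝒩 v {s'})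
    (ht : t ≠ .var y) (hd : I.term π' t = some d) :
    Lifts T r C y I π' (.role 𝒩 s {s'} t (.var y)) :=
  .of_moveUp (.target 𝒩 s v _ t ht hr.idx_eq.symm hv) ⟨_, _, hd, rfl, _, rfl, hr⟩

theorem Lifts.test (hv : StepUp T r 𝒩 s v) (hr : Reach I 𝒩 (π' y) v e f) :
    Lifts T r C y I π' (.test 𝒩 s {f} (.var y)) :=
  .of_moveUp (.test 𝒩 s v _ hv.idx_eq hv) ⟨_, _, rfl, _, rfl, hr⟩

end Lifts

section Step

variable {r : Role RN} {C : Finset CN} {y : VN} {π' : VN → (genModel T 𝒜).Dom}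
  {𝒩 : NNFA CN RN IN} {s s' f : 𝒩.S} {a : IN} {o e : (genModel T 𝒜).Dom}

theorem exists_moveUp_of_pending {i : Fin 𝒩.n} {γ : Atom CN RN IN VN}
    (hγ : γ ∈ pendingAtoms 𝒩 y (pendingStates T r 𝒩 (π' y) i)) :
    ∃ δ, MoveUp T r y γ δ ∧ (genModel T 𝒜).SatAtom π' δ := by
  obtain ⟨u, ⟨-, v, hv, e, f, hf, hr⟩, rfl⟩ := hγ
  exact ⟨_, .test 𝒩 u v _ hv.idx_eq hv, _, e, rfl, f, hf, hr⟩

theorem DownPath.lifts_role (h : DownPath T r C a 𝒩 o (π' y) o s o s') (ha : a ∉ 𝒩.inds)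
    (hC : ↑C ⊆ T.names) (hi : 𝒩.idx s = 𝒩.idx s') :
    Lifts T r C y (genModel T 𝒜) π' (.role 𝒩 s {s'} (.var y) (.var y)) :=
  ⟨_, .jump 𝒩 s s' _ (h.jumpTrans ha hC hi), fun _ => exists_moveUp_of_pending⟩

theorem DownPath.lifts_test (h : DownPath T r C a 𝒩 o (π' y) o s e f) (ha : a ∉ 𝒩.inds)
    (hC : ↑C ⊆ T.names) (hi : 𝒩.idx s = 𝒩.idx f) (hf : f ∈ 𝒩.final) :
    Lifts T r C y (genModel T 𝒜) π' (.test 𝒩 s {f} (.var y)) :=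
  ⟨_, .final 𝒩 s f _ (h.finalTrans ha hC hi hf), fun _ => exists_moveUp_of_pending⟩

/-- Every atom can be decomposed so that all parts can be moved to the predecessor `π' y` of
`π y`. A path from `π y` to itself that does not stay below `π y` is split at its first exit and at
its last entry. -/
theorem exists_decompose [Infinite IN] {π : VN → (genModel T 𝒜).Dom}
    (hy : (π y).1 = ((π' y).1.1, (r, C) :: (π' y).1.2)) (hC : ↑C ⊆ T.names)
    {α : Atom CN RN IN VN} (hα : (genModel T 𝒜).SatAtom π α) (hfin : α.FinalTest)
    (hcon : ∀ B, α ≠ .concept B (.var y))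
    (hne : ∀ t ∈ α.terms, t ≠ .var y → ∀ d, (genModel T 𝒜).term π t = some d →
      ¬ IsBelow (π y) d ∧ (genModel T 𝒜).term π' t = some d)
    (hnv : ∀ v, .var v ∈ α.terms → v ≠ y → π v = π' v) :
    ∃ X, Decompose y α X ∧ ∀ β ∈ X, Lifts T r C y (genModel T 𝒜) π' β := by
  have hkeep : .var y ∉ α.terms →
      ∃ X, Decompose y α X ∧ ∀ β ∈ X, Lifts T r C y (genModel T 𝒜) π' β := by
    intro hyα
    refine ⟨{α}, .keep α hyα, ?_⟩
    rintro _ rfl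
    exact .of_moveUp (.keep _ hyα)
      ((Interp.satAtom_congr fun v hv => hnv v hv (by rintro rfl; exact hyα hv)).1 hα)
  cases α with
  | concept A t => exact hkeep fun h => hcon A (by rw [show Term.var y = t from h])
  | role 𝒩 s F t t' =>
    obtain ⟨a, ha⟩ := 𝒩.finite_inds.exists_notMem
    obtain ⟨d, e, hd, he, f, hf, hr⟩ := hα
    have hif := hr.idx_eq
    by_cases ht : t = .var y
    · subst ht
      cases hd
      by_cases ht' : t' = .var y
      · subst ht'
        cases he
        rcases hr.first_exit hy a (.refl _) with h | ⟨s₁, v, h, hv, hr'⟩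
        · refine ⟨_, .role 𝒩 s F _ _ [] f (.inl rfl) .nil (by simp) hf, ?_⟩
          rintro _ rfl
          exact h.lifts_role ha hC hif
        · have hi₁ : 𝒩.idx s = 𝒩.idx s₁ := by rw [hif, ← hr'.idx_eq, hv.idx_eq]
          rcases hr'.last_entry hy a (.refl _) with ⟨h', -⟩ | ⟨v', s₂, hr₂, hv', h'⟩
          · exact (not_isBelow_parent hy h').elim
          have hi₂ : 𝒩.idx s₂ = 𝒩.idx s₁ := by rw [← hv'.idx_eq, ← hr₂.idx_eq, hv.idx_eq]
          have hif₂ : 𝒩.idx s₂ = 𝒩.idx f := by rw [hi₂, ← hi₁, hif]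
          -- The intermediate states must be distinct; if they agree, the excursion is dropped.
          by_cases hs : s₁ = s₂
          · subst hs
            refine ⟨_, .role 𝒩 s F _ _ [s₁] f (.inl rfl) (by simp) (by simp [hi₁]) hf, ?_⟩
            rintro _ (rfl | rfl)
            exacts [h.lifts_role ha hC hi₁, h'.lifts_role ha hC hif₂]
          · refine ⟨_, .role 𝒩 s F _ _ [s₁, s₂] f (.inl rfl) (by simp [hs]) (by simp [hi₁, hi₂])
              hf, ?_⟩
            rintro _ (rfl | rfl | rfl)
            exacts [h.lifts_role ha hC hi₁, .up_down hv hr₂ hv', h'.lifts_role ha hC hif₂]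
      · obtain ⟨hb, he'⟩ := hne t' (.inr rfl) ht' e he
        rcases hr.first_exit hy a (.refl _) with ⟨_, _, _, _, h, _⟩ | ⟨s₁, v, h, hv, hr'⟩
        · exact (hb h.isBelow).elim
        · have hi₁ : 𝒩.idx s = 𝒩.idx s₁ := by rw [hif, ← hr'.idx_eq, hv.idx_eq]
          refine ⟨_, .role 𝒩 s F _ _ [s₁] f (.inl rfl) (by simp) (by simp [hi₁]) hf, ?_⟩
          rintro _ (rfl | rfl)
          exacts [h.lifts_role ha hC hi₁, .source hv hr' ht' he']
    · by_cases ht' : t' = .var y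
      · subst ht'
        cases he
        obtain ⟨hb, hd'⟩ := hne t (.inl rfl) ht d hd
        rcases hr.last_entry hy a (.refl _) with ⟨h', -⟩ | ⟨v', s₂, hr₂, hv', h'⟩
        · exact (hb h').elim
        have hi₂ : 𝒩.idx s₂ = 𝒩.idx s := by rw [← hv'.idx_eq, ← hr₂.idx_eq]
        refine ⟨_, .role 𝒩 s F _ _ [s₂] f (.inr rfl) (by simp) (by simp [hi₂]) hf, ?_⟩
        rintro _ (rfl | rfl)
        exacts [.target hr₂ hv' ht hd', h'.lifts_role ha hC (hi₂.trans hif)]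
      · exact hkeep fun h => h.elim (fun h => ht h.symm) fun h => ht' h.symm
  | test 𝒩 s F t =>
    obtain ⟨a, ha⟩ := 𝒩.finite_inds.exists_notMem
    obtain ⟨d, e, hd, f, hf, hr⟩ := hα
    have hif := hr.idx_eq
    by_cases ht : t = .var y
    · subst ht
      cases hd
      rcases hr.first_exit hy a (.refl _) with h | ⟨s₁, v, h, hv, hr'⟩
      · refine ⟨_, .test 𝒩 s F [] f .nil (by simp) hf, ?_⟩
        rintro _ rfl
        exact h.lifts_test ha hC hif (hfin hf)
      · have hi₁ : 𝒩.idx s = 𝒩.idx s₁ := by rw [hif, ← hr'.idx_eq, hv.idx_eq]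
        refine ⟨_, .test 𝒩 s F [s₁] f (by simp) (by simp [hi₁]) hf, ?_⟩
        rintro _ (rfl | rfl)
        exacts [h.lifts_role ha hC hi₁, .test hv hr']
    · exact hkeep fun h => ht h.symm

end Step

theorem GenPath.lastConj_subset {a : IN} {l : List (Role RN × Finset CN)} (h : GenPath T 𝒜 a l) :
    ↑(lastConj T 𝒜 a l) ⊆ T.names := by
  cases l with
  | nil => exact fun A hA => (mem_lastConj_nil.1 hA).1
  | cons c l => exact h.1.1.1

/-- If `π` matches `q` and `π y` is an object of maximal length, then all variables at that object
can be merged and moved to its predecessor `o'`. -/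
theorem exists_oneStep [Infinite IN] {k : ℕ} {q : Query CN RN IN VN k}
    (hfin : ∀ α ∈ q.atoms, α.FinalTest) {π : VN → (genModel T 𝒜).Dom}
    (hπ : q.IsMatch (genModel T 𝒜) π) {y : VN} (hy : y ∈ q.vars)
    (hmax : ∀ v ∈ q.vars, (π v).1.2.length ≤ (π y).1.2.length)
    (hans : ∀ i, π (q.ans i) ≠ π y)
    {o' : (genModel T 𝒜).Dom} {r : Role RN} {C : Finset CN}
    (hyo : (π y).1 = (o'.1.1, (r, C) :: o'.1.2)) :
    ∃ q' : Query CN RN IN VN k, OneStep T q q' ∧ q'.ans = q.ans ∧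
      ∃ π' : VN → (genModel T 𝒜).Dom, q'.IsMatch (genModel T 𝒜) π' ∧ π' y = o' ∧
        ∀ v, π' v = π v ∨ π' v = o' ∧ π v = π y := by
  classical
  let L : Set VN := {v | v ∈ q.vars ∧ π v = π y}
  have hyL : y ∈ L := ⟨hy, rfl⟩
  let π' : VN → (genModel T 𝒜).Dom := fun v => if v ∈ L then o' else π v
  have hπ'L : ∀ v ∈ L, π' v = o' := fun v hv => if_pos hv
  have hπ'n : ∀ v ∉ L, π' v = π v := fun v hv => if_neg hv
  have hyo' : (π y).1 = ((π' y).1.1, (r, C) :: (π' y).1.2) := by rw [hπ'L y hyL, hyo]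
  have hgen : GenPath T 𝒜 o'.1.1 ((r, C) :: o'.1.2) := by
    have := (π y).2
    rwa [hyo] at this
  have hC : ↑C ⊆ T.names := hgen.1.1.1
  have hsat : ∀ α ∈ Atom.rename L y '' q.atoms, (genModel T 𝒜).SatAtom π α := by
    rintro _ ⟨α, hα, rfl⟩
    exact (Interp.satAtom_rename (fun v hv => hv.2) α).2 (hπ α hα)
  have hdec : ∀ α ∈ (Atom.rename L y '' q.atoms) \ {α | ∃ B, α = .concept B (.var y)},
      ∃ X, Decompose y α X ∧ ∀ β ∈ X, Lifts T r C y (genModel T 𝒜) π' β := by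
    rintro α ⟨hα, hB⟩
    have hnL : ∀ v, .var v ∈ α.terms → v ≠ y → v ∈ q.vars ∧ v ∉ L := by
      obtain ⟨α₀, hα₀, rfl⟩ := hα
      intro v hv hvy
      refine ⟨?_, fun hvL => hvy (Atom.eq_of_mem_terms_rename hvL hv)⟩
      exact (Atom.eq_or_mem_terms_of_rename hv).elim (fun h => (hvy h).elim)
        fun h => ⟨α₀, hα₀, h⟩
    refine exists_decompose hyo' hC (hsat α hα) ?_ (fun B h => hB ⟨B, h⟩) ?_
      fun v hv hvy => (hπ'n v (hnL v hv hvy).2).symm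
    · obtain ⟨α₀, hα₀, rfl⟩ := hα
      have := hfin α₀ hα₀
      cases α₀ <;> exact this
    · rintro (v | b) ht hty d hd
      · obtain ⟨hv, hvL⟩ := hnL v ht (by rintro rfl; exact hty rfl)
        cases hd
        exact ⟨fun hb => hvL ⟨hv, hb.eq_of_length_le (hmax v hv)⟩, congrArg some (hπ'n v hvL)⟩
      · exact ⟨fun hb => hb.not_ind hyo b hd, hd⟩
  choose! f₄ hf₄ hl using hdec
  have hl' : ∀ β ∈ ⋃ α ∈ (Atom.rename L y '' q.atoms) \ {α | ∃ B, α = .concept B (.var y)}, f₄ α,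
      Lifts T r C y (genModel T 𝒜) π' β := by
    intro β hβ
    obtain ⟨α, hα, hβα⟩ := Set.mem_iUnion₂.1 hβ
    exact hl α hα β hβα
  choose! f₅ hf₅ hm using hl'
  have hm' : ∀ γ ∈ ⋃ β ∈ ⋃ α ∈ (Atom.rename L y '' q.atoms) \ {α | ∃ B, α = .concept B (.var y)},
      f₄ α, f₅ β, ∃ δ, MoveUp T r y γ δ ∧ (genModel T 𝒜).SatAtom π' δ := by
    intro γ hγ
    obtain ⟨β, hβ, hγβ⟩ := Set.mem_iUnion₂.1 hγ
    exact hm β hβ γ hγβ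
  have : Nonempty (Atom CN RN IN VN) := let ⟨α, _⟩ := hy; ⟨α⟩
  choose! f₇ hf₇ hs using hm'
  refine ⟨_, ⟨L, y, C, lastConj T 𝒜 o'.1.1 o'.1.2, r, f₄, f₅, f₇, _, _, _, _, hyL, ?_, rfl, hC, ?_,
    rfl, hf₄, rfl, hf₅, rfl, hgen.2.lastConj_subset, hgen.1.1.2, hf₇, rfl⟩, rfl, π', ?_,
    hπ'L y hyL, ?_⟩
  · rintro v hv
    refine ⟨hv.1, ?_⟩
    rintro ⟨i, rfl⟩
    exact hans i hv.2
  · intro B hB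
    obtain ⟨d, hd, hdB⟩ := hsat _ hB
    cases hd
    change CanCon T 𝒜 B (π y).1 at hdB
    rwa [hyo] at hdB
  · rintro _ (⟨γ, hγ, rfl⟩ | ⟨A, hA, rfl⟩)
    · exact hs γ hγ
    · refine ⟨_, rfl, ?_⟩
      rw [hπ'L y hyL]
      exact canCon_of_lastConj (entailsT_of_mem_conj hA)
  · intro v
    by_cases hv : v ∈ L
    · exact .inr ⟨hπ'L v hv, hv.2⟩
    · exact .inl (hπ'n v hv)

/-- A match in the generated model is moved step by step to the individuals; the sum of the lengths
of the objects to which the variables are sent decreases. -/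
theorem hasCoreMatch_of_genModel [Infinite IN] {k : ℕ} {a : Fin k → IN} (V : Finset VN)
    (q : Query CN RN IN VN k) (hV : q.vars ⊆ V) (hfin : ∀ α ∈ q.atoms, α.FinalTest)
    (π : VN → (genModel T 𝒜).Dom) (hπ : q.IsMatch (genModel T 𝒜) π)
    (hans : ∀ i, (genModel T 𝒜).ind (a i) = some (π (q.ans i))) :
    HasCoreMatch q T 𝒜 a := by
  induction hn : ∑ v ∈ V, (π v).1.2.length using Nat.strong_induction_on generalizing q π with
  | _ n ih =>
  subst hn
  by_cases hall : ∀ v ∈ q.vars, (π v).1.2 = []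
  · refine ⟨q, .refl, _, fun α hα => genModel_isHom.satAtom (Set.subset_univ _) (hπ α hα),
      fun i => genModel_isHom.ind _ (Set.mem_univ _) _ (hans i), fun v hv => ?_⟩
    have h : (π v).1 = ((π v).1.1, []) := Prod.ext rfl (hall v hv)
    refine ⟨(π v).1.1, ?_, canModel_ind.2 h⟩
    have := (π v).2
    rwa [h] at this
  · push Not at hall
    obtain ⟨v₀, hv₀, hne₀⟩ := hall
    obtain ⟨y, hy, hmax⟩ := Set.exists_max_image q.vars (fun v => (π v).1.2.length)
      (V.finite_toSet.subset hV) ⟨v₀, hv₀⟩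
    obtain ⟨⟨r, C⟩, l, hl⟩ : ∃ c l, (π y).1.2 = c :: l := by
      have := hmax v₀ hv₀
      exact List.exists_cons_of_length_pos ((List.length_pos_iff.2 hne₀).trans_le this)
    have hyl : (π y).1 = ((π y).1.1, (r, C) :: l) := Prod.ext rfl hl
    have hgen := (π y).2
    rw [hyl] at hgen
    let o' : (genModel T 𝒜).Dom := ⟨((π y).1.1, l), hgen.2⟩
    obtain ⟨q', hstep, hans', π', hπ', hy', hor⟩ := exists_oneStep hfin hπ hy hmax
      (fun i h => by
        have := genModel_ind.1 (hans i)
        rw [h, hyl] at this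
        simpa using congrArg Prod.snd this) (o' := o') hyl
    have hlen : o'.1.2.length < (π y).1.2.length := by rw [hl]; exact Nat.lt_succ_self _
    have hlt : ∑ v ∈ V, (π' v).1.2.length < ∑ v ∈ V, (π v).1.2.length := by
      refine Finset.sum_lt_sum (fun v _ => ?_) ⟨y, hV hy, by rwa [hy']⟩
      rcases hor v with h | ⟨h, h'⟩
      · rw [h]
      · rw [h, h']
        exact hlen.le
    obtain ⟨q'', hq'', hmatch⟩ := ih _ hlt q' (hstep.vars_subset.trans hV) (hstep.finalTest hfin)
      π' hπ' (fun i => by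
        rw [hans i, hans']
        rcases hor (q.ans i) with h | ⟨-, h⟩
        · rw [h]
        · have := genModel_ind.1 (hans i)
          rw [h, hyl] at this
          simpa using congrArg Prod.snd this) rfl
    exact ⟨q'', .head hstep hq'', hmatch⟩

theorem Query.IsCN2RPQ.finite_vars {k : ℕ} {q : Query CN RN IN VN k} (hq : q.IsCN2RPQ) :
    q.vars.Finite := by
  have h : q.vars = ⋃ α ∈ q.atoms, Term.var ⁻¹' α.terms := by ext v; simp [Query.vars]
  rw [h]
  refine hq.finite.biUnion fun α _ => Set.Finite.preimage (fun _ _ _ _ h => Term.var.inj h) ?_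
  cases α with
  | concept => exact Set.finite_singleton _
  | role => exact (Set.finite_singleton _).insert _
  | test => exact Set.finite_singleton _

theorem Query.certainAnswer_iff_hasCoreMatch [Infinite IN] {k : ℕ} (hT : T.IsNormal)
    (h𝒜 : 𝒜.IsNormal) (hne : 𝒜.Nonempty) (hcons : Consistent T 𝒜) {q : Query CN RN IN VN k}
    (hq : q.IsCN2RPQ) (hqi : q.inds ⊆ 𝒜.inds) {a : Fin k → IN} (ha : ∀ i, a i ∈ 𝒜.inds) :
    q.CertainAnswer T 𝒜 a ↔ HasCoreMatch q T 𝒜 a := by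
  refine ⟨fun h => ?_, HasCoreMatch.certainAnswer⟩
  obtain ⟨π, hπ, hans⟩ := h.exists_genModel hT h𝒜 hne hcons hqi ha
  refine hasCoreMatch_of_genModel hq.finite_vars.toFinset q (by simp) (fun α hα => ?_) π hπ hans
  cases α with
  | concept => trivial
  | role => trivial
  | test 𝒩 s F t => exact (hq.no_test 𝒩 s F t hα).elim

/-! ### Certain answers -/

theorem NREAtom.RepresentedBy.satAtom_iff {α : NREAtom CN RN IN VN} {β : Atom CN RN IN VN}
    (h : α.RepresentedBy β) {I : Interp CN RN IN} (hI : I.Proper) (π : VN → I.Dom) :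
    I.SatNREAtom π α ↔ I.SatAtom π β := by
  cases h with
  | concept A t => exact Iff.rfl
  | role E 𝒩 s F t t' h => simp only [Interp.SatNREAtom, Interp.SatAtom, h I hI]

theorem NREQuery.RepresentedBy.certainAnswer_iff {k : ℕ} {q₀ : NREQuery CN RN IN VN k}
    {q : Query CN RN IN VN k} (h : q₀.RepresentedBy q) {a : Fin k → IN} :
    q₀.CertainAnswer T 𝒜 a ↔ q.CertainAnswer T 𝒜 a := by
  obtain ⟨hans, h₁, h₂⟩ := h
  refine forall₂_congr fun I hI => exists_congr fun π => and_congr ⟨fun hs β hβ => ?_,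
    fun hs α hα => ?_⟩ (by rw [hans])
  · obtain ⟨α, hα, hαβ⟩ := h₂ β hβ
    exact (hαβ.satAtom_iff hI.1.1 π).1 (hs α hα)
  · obtain ⟨β, hβ, hαβ⟩ := h₁ α hα
    exact (hαβ.satAtom_iff hI.1.1 π).2 (hs β hβ)

end NestedQuery

theorem mainTheorem9 {CN RN IN VN : Type} [Infinite IN] {k : ℕ}
    (T : NestedQuery.TBox CN RN) (𝒜 : NestedQuery.ABox CN RN IN)
    (hT : T.IsNormal) (h𝒜 : 𝒜.IsNormal) (hne : 𝒜.Nonempty)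
    (hcons : NestedQuery.Consistent T 𝒜)
    (q : NestedQuery.Query CN RN IN VN k) (hq : q.IsCN2RPQ) (hqi : q.inds ⊆ 𝒜.inds)
    (a : Fin k → IN) (ha : ∀ i, a i ∈ 𝒜.inds) :
    (q.CertainAnswer T 𝒜 a ↔ NestedQuery.HasCoreMatch q T 𝒜 a) ∧
    ∀ q₀ : NestedQuery.NREQuery CN RN IN VN k, q₀.RepresentedBy q →
      (q₀.CertainAnswer T 𝒜 a ↔ NestedQuery.HasCoreMatch q T 𝒜 a) := by
  have h := NestedQuery.Query.certainAnswer_iff_hasCoreMatch hT h𝒜 hne hcons hq hqi ha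
  exact ⟨h, fun q₀ hq₀ => hq₀.certainAnswer_iff.trans h⟩
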